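/- **Theorem 4.2.** The equation of Gauss is a consequence of the equations of Codazzi and Ricci for purely real surfaces in any Kaehler surface. In detail: Let $(\tilde M,\tilde g,J)$ be a Kaehler surface: a smooth manifold of real dimension $4$ with a Riemannian metric $\tilde g=\langle\ ,\ \rangle$ and a smooth almost complex structure $J$ such that $\langle JX,JY\rangle=\langle X,Y\rangle$ and $\tilde\nabla J=0$, where $\tilde\nabla$ is the Levi-Civita connection of $\tilde g$, with curvature tensor $\tilde R(X,Y)=[\tilde\nabla_X,\tilde\nabla_Y]-\tilde\nabla_{[X,Y]}$. Let $\phi\colon M\to\tilde M$ be a smooth immersion of a surface that is purely real, i.e. $J(TM)\cap TM=\{0\}$. Give $M$ the induced metric, with Levi-Civita connection $\nabla$ and curvature tensor $R$, and let $^\top$, $^\perp$ denote the tangential and normal components. For $h\colon TM\times TM\to T^\perp M$, endomorphisms $A_\xi$ of $TM$ ($\xi$ normal) and a connection $D$ on $T^\perp M$, consider, for all vector fields $X,Y,Z$ tangent to $M$ and $\xi$ normal to $M$, the equations of Gauss, Codazzi and Ricci $$(\tilde R(X,Y)Z)^\top=R(X,Y)Z+A_{h(X,Z)}Y-A_{h(Y,Z)}X,$$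 $$(\tilde R(X,Y)Z)^\perp=(\bar\nabla_Xh)(Y,Z)-(\bar\nabla_Yh)(X,Z),$$ $$(\tilde R(X,Y)\xi)^\perp=h(A_\xi X,Y)-h(X,A_\xi Y)+R^D(X,Y)\xi,$$ where $(\bar\nabla_Xh)(Y,Z)=D_Xh(Y,Z)-h(\nabla_XY,Z)-h(Y,\nabla_XZ)$ and $R^D(X,Y)=[D_X,D_Y]-D_{[X,Y]}$. 1. Let $h$, $A$, $D$ be the second fundamental form, the shape operators and the normal connection of $\phi$, defined by the formulas of Gauss and Weingarten $\tilde\nabla_XY=\nabla_XY+h(X,Y)$ and $\tilde\nabla_X\xi=-A_\xi X+D_X\xi$. If the equations of Codazzi and Ricci hold, then the equation of Gauss holds. 2. The implication is a formal one: it holds for every smooth symmetric bilinear form $h\colon TM\times TM\to T^\perp M$, with $A$ given by $\langle A_\xi X,Y\rangle=\langle h(X,Y),\xi\rangle$, and every smooth metric connection $D$ on $T^\perp M$, not necessarily those of $\phi$, such that $J$ is parallel with respect to the connection $Y+\xi\mapsto\nabla_XY+h(X,Y)-A_\xi X+D_X\xi$ on $TM\oplus T^\perp M=\phi^*T\tilde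 M$. If such $h$, $A$, $D$ satisfy the equations of Codazzi and Ricci, then they satisfy the equation of Gauss. -/

import Mathlib

open Bundle
open scoped Manifold ContDiff

noncomputable section

namespace KaehlerSurface

section Connections

variable {E : Type*} [NormedAddCommGroup E] [NormedSpace ℝ E] [FiniteDimensional ℝ E]
  {H : Type*} [TopologicalSpace H] (I : ModelWithCorners ℝ E H)
  {M : Type*} [TopologicalSpace M] [ChartedSpace H M] [IsManifold I ∞ M]

instance instFiniteDimensionalTangentSpace (x : M) : FiniteDimensional ℝ (TangentSpace I x) :=
  inferInstanceAs (FiniteDimensional ℝ E)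

/-- The vector field `X` is smooth at the point `x`. -/
def SmoothAt (X : Π x : M, TangentSpace I x) (x : M) : Prop :=
  ContMDiffAt I I.tangent ∞ (fun y => (⟨y, X y⟩ : TangentBundle I M)) x

/-- The vector field `X` is differentiable at the point `x`. -/
def DiffAt (X : Π x : M, TangentSpace I x) (x : M) : Prop :=
  MDifferentiableAt I I.tangent (fun y => (⟨y, X y⟩ : TangentBundle I M)) x

variable {I}

/-- The curvature `R(X,Y)Z = ∇_X ∇_Y Z - ∇_Y ∇_X Z - ∇_{[X,Y]} Z` of vector fields, at `x`
(`cov Z x (X x)` is `(∇_X Z)(x)`). -/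
def curvature (cov : CovariantDerivative I E (TangentSpace I : M → Type _))
    (X Y Z : Π x : M, TangentSpace I x) (x : M) : TangentSpace I x :=
  cov (fun y => cov Z y (Y y)) x (X x) - cov (fun y => cov Z y (X y)) x (Y x)
    - cov Z x (VectorField.mlieBracket I X Y x)

/-- The curvature tensor `R(u,v)w` at a point: `u`, `v`, `w` are extended to vector fields
that are smooth near the point (with constant components in a chart). -/
def curvatureTensor (cov : CovariantDerivative I E (TangentSpace I : M → Type _))
    (x : M) (u v w : TangentSpace I x) : TangentSpace I x :=
  curvature cov (FiberBundle.extend E u) (FiberBundle.extend E v) (FiberBundle.extend E w) x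

variable [RiemannianBundle (fun x : M => TangentSpace I x)]
  [IsContMDiffRiemannianBundle I ∞ E (fun x : M => TangentSpace I x)]

/-- `cov` is the Levi-Civita connection of the Riemannian metric: a smooth connection on the
tangent bundle which is metric and torsion-free. -/
structure IsLeviCivita (cov : CovariantDerivative I E (TangentSpace I : M → Type _)) : Prop where
  smooth : ∀ (X Y : Π x : M, TangentSpace I x) (x : M), SmoothAt I X x → SmoothAt I Y x →
    SmoothAt I (fun y => cov Y y (X y)) x
  torsion_free : cov.torsion = 0
  metric : ∀ (Y Z : Π x : M, TangentSpace I x) (x : M), DiffAt I Y x → DiffAt I Z x →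
    ∀ u : TangentSpace I x, mvfderiv I (fun y => inner ℝ (Y y) (Z y)) x u =
      inner ℝ (cov Y x u) (Z x) + inner ℝ (Y x) (cov Z x u)

/-- `(g, J)` is a Kaehler structure: `J` is a smooth almost complex structure, the metric is
`J`-Hermitian and `J` is parallel for the Levi-Civita connection `cov` of the metric. -/
structure IsKaehler (cov : CovariantDerivative I E (TangentSpace I : M → Type _))
    (J : Π x : M, TangentSpace I x →L[ℝ] TangentSpace I x) : Prop where
  leviCivita : IsLeviCivita cov
  smooth : ContMDiff I (I.prod 𝓘(ℝ, E →L[ℝ] E)) ∞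
    (fun x => Bundle.TotalSpace.mk' (E →L[ℝ] E)
      (E := fun x : M => TangentSpace I x →L[ℝ] TangentSpace I x) x (J x))
  sq : ∀ (x : M) (u : TangentSpace I x), J x (J x u) = -u
  hermitian : ∀ (x : M) (u v : TangentSpace I x), inner ℝ (J x u) (J x v) = inner ℝ u v
  parallel : ∀ (Y : Π x : M, TangentSpace I x) (x : M), DiffAt I Y x →
    ∀ u : TangentSpace I x, cov (fun y => J y (Y y)) x u = J x (cov Y x u)

end Connections

section Surfaces

variable {M : Type*} [TopologicalSpace M] [ChartedSpace (EuclideanSpace ℝ (Fin 2)) M]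
  [IsManifold (𝓡 2) ∞ M]
  {N : Type*} [TopologicalSpace N] [ChartedSpace (EuclideanSpace ℝ (Fin 4)) N]
  [IsManifold (𝓡 4) ∞ N]

/-- Vector fields along a map `φ : M → N`, that is, sections of the pulled back bundle. -/
abbrev FieldAlong (φ : M → N) := Π x : M, TangentSpace (𝓡 4) (φ x)

/-- The field `V` along `φ` is smooth at `x`. -/
def SmoothAlongAt (φ : M → N) (V : FieldAlong φ) (x : M) : Prop :=
  ContMDiffAt (𝓡 2) (𝓡 4).tangent ∞ (fun y => (⟨φ y, V y⟩ : TangentBundle (𝓡 4) N)) x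

/-- The field `V` along `φ` is differentiable at `x`. -/
def DiffAlongAt (φ : M → N) (V : FieldAlong φ) (x : M) : Prop :=
  MDifferentiableAt (𝓡 2) (𝓡 4).tangent (fun y => (⟨φ y, V y⟩ : TangentBundle (𝓡 4) N)) x

/-- The differential of `φ` at `x`. -/
abbrev dmap (φ : M → N) (x : M) : TangentSpace (𝓡 2) x →L[ℝ] TangentSpace (𝓡 4) (φ x) :=
  mfderiv (𝓡 2) (𝓡 4) φ x

/-- The covariant derivative `∇_u V` of a field `V = ∑ Vⁱ (Eᵢ ∘ φ)` along `φ` (the pulled back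
connection): `∑ dVⁱ(u) Eᵢ + Vⁱ(x) ∇_{dφ u} Eᵢ`, for the coordinate frame `Eᵢ` of the preferred
chart at `φ x`. The second sum is the derivative of the field `∑ Vⁱ(x) Eᵢ` extending `V x`. -/
def covAlong (cov : CovariantDerivative (𝓡 4) (EuclideanSpace ℝ (Fin 4))
      (TangentSpace (𝓡 4) : N → Type _))
    (φ : M → N) (V : FieldAlong φ) (x : M) (u : TangentSpace (𝓡 2) x) :
    TangentSpace (𝓡 4) (φ x) :=
  let t := trivializationAt (EuclideanSpace ℝ (Fin 4)) (TangentSpace (𝓡 4) : N → Type _) (φ x)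
  t.symm (φ x) (mvfderiv (𝓡 2) (fun y : M => (t ⟨φ y, V y⟩).2) x u)
    + cov (FiberBundle.extend (EuclideanSpace ℝ (Fin 4)) (V x)) (φ x) (dmap φ x u)

variable [RiemannianBundle (fun x : M => TangentSpace (𝓡 2) x)]
  [RiemannianBundle (fun y : N => TangentSpace (𝓡 4) y)]

/-- `φ` is a smooth isometric immersion: the metric of `M` is the one induced by `φ`. -/
structure IsIsometricImmersion (φ : M → N) : Prop where
  smooth : ContMDiff (𝓡 2) (𝓡 4) ∞ φ
  isometric : ∀ (x : M) (u v : TangentSpace (𝓡 2) x),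
    inner ℝ (dmap φ x u) (dmap φ x v) = inner ℝ u v

/-- `φ` is purely real: `J(TM) ∩ TM = {0}`. -/
def IsPurelyReal (J : Π y : N, TangentSpace (𝓡 4) y →L[ℝ] TangentSpace (𝓡 4) y)
    (φ : M → N) : Prop :=
  ∀ x : M, (dmap φ x).range.map (J (φ x) : TangentSpace (𝓡 4) (φ x) →ₗ[ℝ] _) ⊓
    (dmap φ x).range = ⊥

/-- The normal space of `φ` at `x`. -/
def normalSpace (φ : M → N) (x : M) : Submodule ℝ (TangentSpace (𝓡 4) (φ x)) :=
  (dmap φ x).rangeᗮ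

/-- Normal vector fields. -/
def IsNormalField (φ : M → N) (ξ : FieldAlong φ) : Prop :=
  ∀ x : M, ξ x ∈ normalSpace φ x

/-- The tangential component `w^⊤`, as a vector tangent to `M`: the adjoint of the differential.
When `φ` is isometric, `dφ (w^⊤)` is the orthogonal projection of `w` to `dφ (T_x M)`. -/
def tangentialPart (φ : M → N) (x : M) : TangentSpace (𝓡 4) (φ x) →ₗ[ℝ] TangentSpace (𝓡 2) x :=
  LinearMap.adjoint (dmap φ x : TangentSpace (𝓡 2) x →ₗ[ℝ] TangentSpace (𝓡 4) (φ x))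

/-- The normal component `w^⊥ = w - w^⊤`. -/
def normalPart (φ : M → N) (x : M) (w : TangentSpace (𝓡 4) (φ x)) : TangentSpace (𝓡 4) (φ x) :=
  w - dmap φ x (tangentialPart φ x w)

/-- A second fundamental form `h`, shape operators `A` and an operator `D` of normal
differentiation along `φ`: `h x u v` is `h(u,v)`, `A x ξ u` is `A_ξ u` and `D ξ x u` is `D_u ξ`.
Only the values of `A` on normal vectors and of `D` on normal fields are used. -/
structure FundamentalForms (φ : M → N) where
  h : Π x : M, TangentSpace (𝓡 2) x →L[ℝ] TangentSpace (𝓡 2) x →L[ℝ] TangentSpace (𝓡 4) (φ x)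
  A : Π x : M, TangentSpace (𝓡 4) (φ x) →L[ℝ] TangentSpace (𝓡 2) x →L[ℝ] TangentSpace (𝓡 2) x
  D : FieldAlong φ → Π x : M, TangentSpace (𝓡 2) x →L[ℝ] TangentSpace (𝓡 4) (φ x)

/-- `h` and `D` take normal values. -/
structure FundamentalForms.NormalValued {φ : M → N} (s : FundamentalForms φ) : Prop where
  h_normal : ∀ (x : M) (u v : TangentSpace (𝓡 2) x), s.h x u v ∈ normalSpace φ x
  D_normal : ∀ ξ : FieldAlong φ, IsNormalField φ ξ →
    ∀ (x : M) (u : TangentSpace (𝓡 2) x), s.D ξ x u ∈ normalSpace φ x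

variable
  (covN : CovariantDerivative (𝓡 4) (EuclideanSpace ℝ (Fin 4)) (TangentSpace (𝓡 4) : N → Type _))
  (covM : CovariantDerivative (𝓡 2) (EuclideanSpace ℝ (Fin 2)) (TangentSpace (𝓡 2) : M → Type _))

/-- `h`, `A`, `D` are the second fundamental form, the shape operators and the normal connection
of `φ`: the formulas of Gauss and Weingarten hold. -/
structure FundamentalForms.IsInduced {φ : M → N} (s : FundamentalForms φ) : Prop
    extends s.NormalValued where
  gauss_formula : ∀ (Y : Π x : M, TangentSpace (𝓡 2) x) (x : M), DiffAt (𝓡 2) Y x →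
    ∀ u : TangentSpace (𝓡 2) x, covAlong covN φ (fun y => dmap φ y (Y y)) x u =
      dmap φ x (covM Y x u) + s.h x u (Y x)
  weingarten_formula : ∀ ξ : FieldAlong φ, IsNormalField φ ξ → ∀ x : M, DiffAlongAt φ ξ x →
    ∀ u : TangentSpace (𝓡 2) x, covAlong covN φ ξ x u =
      -dmap φ x (s.A x (ξ x) u) + s.D ξ x u

/-- The connection on the bundle `TM ⊕ T^⊥M` along `φ` that is assembled from `∇`, `h`, `A`, `D`
as in the formulas of Gauss and Weingarten:
`(Y + ξ) ↦ ∇_u Y + h(u,Y) - A_ξ u + D_u ξ`. -/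
def FundamentalForms.connection {φ : M → N} (s : FundamentalForms φ) (V : FieldAlong φ) (x : M)
    (u : TangentSpace (𝓡 2) x) : TangentSpace (𝓡 4) (φ x) :=
  dmap φ x (covM (fun y => tangentialPart φ y (V y)) x u) + s.h x u (tangentialPart φ x (V x))
    - dmap φ x (s.A x (normalPart φ x (V x)) u) + s.D (fun y => normalPart φ y (V y)) x u

/-- `h`, `A`, `D` are admissible data along `φ`, not necessarily those of `φ`: `h` is a smooth
symmetric normal-valued form, `A` is dual to `h`, `D` is a smooth metric connection on the normal
bundle, and `J` is parallel for the connection on `TM ⊕ T^⊥M` assembled from `∇`, `h`, `A`, `D`. -/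
structure FundamentalForms.IsAdmissible
    (J : Π y : N, TangentSpace (𝓡 4) y →L[ℝ] TangentSpace (𝓡 4) y)
    {φ : M → N} (s : FundamentalForms φ) : Prop extends s.NormalValued where
  h_smooth : ∀ (X Y : Π x : M, TangentSpace (𝓡 2) x) (x : M),
    SmoothAt (𝓡 2) X x → SmoothAt (𝓡 2) Y x → SmoothAlongAt φ (fun y => s.h y (X y) (Y y)) x
  h_symm : ∀ (x : M) (u v : TangentSpace (𝓡 2) x), s.h x u v = s.h x v u
  A_dual : ∀ (x : M) (u v : TangentSpace (𝓡 2) x), ∀ ξ ∈ normalSpace φ x,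
    inner ℝ (s.h x u v) ξ = inner ℝ (s.A x ξ u) v
  D_smooth : ∀ (X : Π x : M, TangentSpace (𝓡 2) x) (ξ : FieldAlong φ), IsNormalField φ ξ →
    ∀ x : M, SmoothAt (𝓡 2) X x → SmoothAlongAt φ ξ x →
      SmoothAlongAt φ (fun y => s.D ξ y (X y)) x
  D_add : ∀ ξ η : FieldAlong φ, IsNormalField φ ξ → IsNormalField φ η →
    ∀ x : M, DiffAlongAt φ ξ x → DiffAlongAt φ η x → s.D (ξ + η) x = s.D ξ x + s.D η x
  D_leibniz : ∀ (f : M → ℝ) (ξ : FieldAlong φ), IsNormalField φ ξ →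
    ∀ x : M, MDifferentiableAt (𝓡 2) 𝓘(ℝ, ℝ) f x → DiffAlongAt φ ξ x →
    ∀ u : TangentSpace (𝓡 2) x,
      s.D (fun y => f y • ξ y) x u = f x • s.D ξ x u + mvfderiv (𝓡 2) f x u • ξ x
  D_metric : ∀ ξ η : FieldAlong φ, IsNormalField φ ξ → IsNormalField φ η →
    ∀ x : M, DiffAlongAt φ ξ x → DiffAlongAt φ η x → ∀ u : TangentSpace (𝓡 2) x,
      mvfderiv (𝓡 2) (fun y => inner ℝ (ξ y) (η y)) x u =
        inner ℝ (s.D ξ x u) (η x) + inner ℝ (ξ x) (s.D η x u)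
  J_parallel : ∀ (V : FieldAlong φ) (x : M), DiffAlongAt φ V x → ∀ u : TangentSpace (𝓡 2) x,
    s.connection covM (fun y => J (φ y) (V y)) x u = J (φ x) (s.connection covM V x u)

/-- `(∇̄_X h)(Y,Z) = D_X (h(Y,Z)) - h(∇_X Y, Z) - h(Y, ∇_X Z)`. -/
def FundamentalForms.derivH {φ : M → N} (s : FundamentalForms φ)
    (X Y Z : Π x : M, TangentSpace (𝓡 2) x) (x : M) : TangentSpace (𝓡 4) (φ x) :=
  s.D (fun y => s.h y (Y y) (Z y)) x (X x) - s.h x (covM Y x (X x)) (Z x)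
    - s.h x (Y x) (covM Z x (X x))

/-- `R^D(X,Y)ξ = D_X D_Y ξ - D_Y D_X ξ - D_{[X,Y]} ξ`. -/
def FundamentalForms.normalCurvature {φ : M → N} (s : FundamentalForms φ)
    (X Y : Π x : M, TangentSpace (𝓡 2) x) (ξ : FieldAlong φ) (x : M) :
    TangentSpace (𝓡 4) (φ x) :=
  s.D (fun y => s.D ξ y (Y y)) x (X x) - s.D (fun y => s.D ξ y (X y)) x (Y x)
    - s.D ξ x (VectorField.mlieBracket (𝓡 2) X Y x)

/-- The equation of Gauss,
`(R̃(X,Y)Z)^⊤ = R(X,Y)Z + A_{h(X,Z)} Y - A_{h(Y,Z)} X`. -/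
def FundamentalForms.GaussEquation {φ : M → N} (s : FundamentalForms φ) : Prop :=
  ∀ (X Y Z : Π x : M, TangentSpace (𝓡 2) x) (x : M),
    SmoothAt (𝓡 2) X x → SmoothAt (𝓡 2) Y x → SmoothAt (𝓡 2) Z x →
    tangentialPart φ x (curvatureTensor covN (φ x) (dmap φ x (X x)) (dmap φ x (Y x)) (dmap φ x (Z x))) =
      curvature covM X Y Z x + s.A x (s.h x (X x) (Z x)) (Y x) - s.A x (s.h x (Y x) (Z x)) (X x)

/-- The equation of Codazzi,
`(R̃(X,Y)Z)^⊥ = (∇̄_X h)(Y,Z) - (∇̄_Y h)(X,Z)`. -/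
def FundamentalForms.CodazziEquation {φ : M → N} (s : FundamentalForms φ) : Prop :=
  ∀ (X Y Z : Π x : M, TangentSpace (𝓡 2) x) (x : M),
    SmoothAt (𝓡 2) X x → SmoothAt (𝓡 2) Y x → SmoothAt (𝓡 2) Z x →
    normalPart φ x (curvatureTensor covN (φ x) (dmap φ x (X x)) (dmap φ x (Y x)) (dmap φ x (Z x))) =
      s.derivH covM X Y Z x - s.derivH covM Y X Z x

/-- The equation of Ricci,
`(R̃(X,Y)ξ)^⊥ = h(A_ξ X, Y) - h(X, A_ξ Y) + R^D(X,Y)ξ`. -/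
def FundamentalForms.RicciEquation {φ : M → N} (s : FundamentalForms φ) : Prop :=
  ∀ (X Y : Π x : M, TangentSpace (𝓡 2) x) (ξ : FieldAlong φ) (x : M), IsNormalField φ ξ →
    SmoothAt (𝓡 2) X x → SmoothAt (𝓡 2) Y x → SmoothAlongAt φ ξ x →
    normalPart φ x (curvatureTensor covN (φ x) (dmap φ x (X x)) (dmap φ x (Y x)) (ξ x)) =
      s.h x (s.A x (ξ x) (X x)) (Y x) - s.h x (X x) (s.A x (ξ x) (Y x))
        + s.normalCurvature X Y ξ x

end Surfaces

end KaehlerSurface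

end

open KaehlerSurface

/-!
# The equation of Gauss from the equations of Codazzi and Ricci

Let `∇̂` be the connection on `φ^* TN = TM ⊕ T^⊥M` assembled from `∇`, `h`, `A` and `D`
(`FundamentalForms.connection`), let `K(X,Y)` be its curvature, and let
`Δ = R̃(X,Y) - K(X,Y)`, an operator on `T_{φ(x)} N`. The tangential part of `K(X,Y) dφ Z` and the
normal parts of `K(X,Y) dφ Z` and `K(X,Y) ξ` are the right-hand sides of the equations of Gauss,
Codazzi and Ricci, so that

* Codazzi says that `Δ` maps tangent vectors to tangent vectors,
* Ricci says that `Δ` maps normal vectors to tangent vectors,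
* Gauss says that the tangential part of `Δ` vanishes on tangent vectors.

Both `R̃` and `K` are curvatures of metric connections for which `J` is parallel (`∇̂` is metric
because `A` is dual to `h` and `D` is metric). Hence `Δ` is skew-symmetric
(`inner_sectionCurvature_skew`) and commutes with `J`. By Codazzi and Ricci the image of `Δ` lies in
`dφ(T_x M)`; it is invariant under `J`, and therefore zero as the surface is purely real
(`eq_zero_of_skew_of_commute`). So `Δ = 0`, which contains the equation of Gauss
(`FundamentalForms.IsAdmissible.gaussEquation`). That `K(X,Y)V` depends on the value of `V` at the
point only is again a consequence of skew-symmetry (`connectionCurvature_congr`).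

For the forms induced by `φ`, the formulas of Gauss and Weingarten say that `∇̂` is the pulled back
Levi-Civita connection (`connection_eq_covAlong`). The latter is smooth, metric and torsion-free,
and `J` is parallel for it; this makes the induced forms admissible
(`FundamentalForms.IsInduced.isAdmissible`), so that the first statement is a case of the second.
These properties of the pulled back connection are local and compatible with sums and with products
by functions, and so they need only be checked on restrictions of vector fields of `N` with constant
components in a chart (`along_induction`).
-/

open scoped Topology

noncomputable section

set_option linter.unusedSectionVars false

namespace KaehlerSurface

/-! ### The Lie bracket as a commutator of derivations -/

section BracketDerivation

variable {E : Type*} [NormedAddCommGroup E] [NormedSpace ℝ E]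
  {H : Type*} [TopologicalSpace H] {I : ModelWithCorners ℝ E H}
  {M : Type*} [TopologicalSpace M] [ChartedSpace H M]
  {F : Type*} [NormedAddCommGroup F] [NormedSpace ℝ F]
  {G : Type*} [NormedAddCommGroup G] [NormedSpace ℝ G]

lemma mvfderiv_comp_fderiv {f : M → F} {g : F → G} {x : M} (hg : DifferentiableAt ℝ g (f x))
    (hf : MDifferentiableAt I 𝓘(ℝ, F) f x) (v : TangentSpace I x) :
    mvfderiv I (g ∘ f) x v = fderiv ℝ g (f x) (mvfderiv I f x v) := by
  have h := mfderiv_comp x hg.mdifferentiableAt hf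
  rw [mfderiv_eq_fderiv] at h
  exact congrArg (fun T => T v) h

lemma mvfderiv_congr {f g : M → F} {x : M} (h : f =ᶠ[𝓝 x] g) :
    mvfderiv I f x = mvfderiv I g x := by
  have h' := h.mfderiv_eq (I := I) (I' := 𝓘(ℝ, F))
  ext v
  exact congrArg (fun T => T v) h'

variable [IsManifold I ∞ M]

lemma contDiffAt_comp_extChartAt_symm [I.Boundaryless] {f : M → F} {x y : M} {n : WithTop ℕ∞}
    (hn : n ≤ ∞) (hf : ContMDiffAt I 𝓘(ℝ, F) n f y) (hy : y ∈ (extChartAt I x).source) :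
    ContDiffAt ℝ n (f ∘ (extChartAt I x).symm) (extChartAt I x y) := by
  have := IsManifold.of_le (M := M) (I := I) hn
  rw [← contMDiffAt_iff_contDiffAt]
  have h1 : ContMDiffAt 𝓘(ℝ, E) I n (extChartAt I x).symm (extChartAt I x y) :=
    (contMDiffOn_extChartAt_symm x).contMDiffAt
      ((isOpen_extChartAt_target x).mem_nhds ((extChartAt I x).map_source hy))
  refine ContMDiffAt.comp (I' := I) _ ?_ h1
  rwa [(extChartAt I x).left_inv hy]

/-- The vector field `X` read in the preferred chart at `x`, as a map of the model space. -/
def chartField (X : Π y : M, TangentSpace I y) (x : M) : E → E :=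
  VectorField.mpullbackWithin 𝓘(ℝ, E) I (extChartAt I x).symm X (Set.range I)

lemma chartField_extChartAt {x y : M} (X : Π y : M, TangentSpace I y)
    (hy : y ∈ (extChartAt I x).source) :
    chartField X x (extChartAt I x y) = mvfderiv I (extChartAt I x) y (X y) := by
  have hp : extChartAt I x y ∈ (extChartAt I x).target := (extChartAt I x).map_source hy
  have h := ContinuousLinearMap.inverse_eq
    (mfderivWithin_extChartAt_symm_comp_mfderiv_extChartAt (I := I) hp)
    (mfderiv_extChartAt_comp_mfderivWithin_extChartAt_symm (I := I) hp)
  have h' : chartField X x (extChartAt I x y) = mvfderiv I (extChartAt I x)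
      ((extChartAt I x).symm (extChartAt I x y)) (X ((extChartAt I x).symm (extChartAt I x y))) :=
    congrArg (fun T => T (X ((extChartAt I x).symm (extChartAt I x y)))) h
  rw [h', (extChartAt I x).left_inv hy]

lemma differentiableAt_chartField [CompleteSpace E] [I.Boundaryless]
    {X : Π y : M, TangentSpace I y} {x : M}
    (hX : MDifferentiableAt I I.tangent (fun y => (⟨y, X y⟩ : TangentBundle I M)) x) :
    DifferentiableAt ℝ (chartField X x) (extChartAt I x x) := by
  have : IsManifold I 2 M := IsManifold.of_le (n := ∞) (by norm_cast)
  have h := (mdifferentiableWithinAt_univ.2 hX).differentiableWithinAt_mpullbackWithin_vectorField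
  rw [Set.preimage_univ, Set.univ_inter] at h
  have h' : DifferentiableWithinAt ℝ (chartField X x) (Set.range I) (extChartAt I x x) := h
  rwa [I.range_eq_univ, differentiableWithinAt_univ] at h'

lemma contDiffAt_chartField [CompleteSpace E] [I.Boundaryless]
    {X : Π y : M, TangentSpace I y} {x : M}
    (hX : ContMDiffAt I I.tangent ∞ (fun y => (⟨y, X y⟩ : TangentBundle I M)) x) :
    ContDiffAt ℝ ∞ (chartField X x) (extChartAt I x x) := by
  have h := VectorField.contMDiffWithinAt_mpullbackWithin_extChartAt_symm
    (contMDiffWithinAt_univ.2 hX) (n := ∞) uniqueMDiffOn_univ (Set.mem_univ x) (by simp)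
  rw [Set.preimage_univ, Set.inter_univ] at h
  have h : ContDiffWithinAt ℝ ∞ (chartField X x) (extChartAt I x).target (extChartAt I x x) :=
    contMDiffWithinAt_vectorSpace_iff_contDiffWithinAt.1 h
  exact h.contDiffAt (extChartAt_target_mem_nhds x)

lemma mvfderiv_extChartAt_mlieBracket [I.Boundaryless] (X Y : Π y : M, TangentSpace I y) (x : M) :
    mvfderiv I (extChartAt I x) x (VectorField.mlieBracket I X Y x) =
      fderiv ℝ (chartField Y x) (extChartAt I x x) (chartField X x (extChartAt I x x))
        - fderiv ℝ (chartField X x) (extChartAt I x x) (chartField Y x (extChartAt I x x)) := by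
  have : IsManifold I 2 M := IsManifold.of_le (n := ∞) (by norm_cast)
  obtain ⟨e, he⟩ := isInvertible_mfderiv_extChartAt (I := I) (mem_extChartAt_source x)
  have h : VectorField.mlieBracket I X Y x = (mfderiv I 𝓘(ℝ, E) (extChartAt I x) x).inverse
      (show E from VectorField.lieBracketWithin ℝ (chartField X x) (chartField Y x)
        ((extChartAt I x).symm ⁻¹' Set.univ ∩ Set.range I) (extChartAt I x x)) := by
    rw [← VectorField.mlieBracketWithin_univ]
    exact VectorField.mlieBracketWithin_apply
  rw [Set.preimage_univ, Set.univ_inter, I.range_eq_univ, VectorField.lieBracketWithin_univ,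
    ← he, ContinuousLinearMap.inverse_equiv] at h
  have h2 : ∀ v : E, mvfderiv I (extChartAt I x) x (e.symm v) = v := fun v =>
    (congrArg (fun T => T (e.symm v)) he).symm.trans (e.apply_symm_apply v)
  exact (congrArg _ h).trans (h2 _)

lemma mvfderiv_eventuallyEq_chart [I.Boundaryless] {f : M → F} {x : M}
    (hf : ContMDiffAt I 𝓘(ℝ, F) 2 f x) (X : Π y : M, TangentSpace I y) :
    (fun y => mvfderiv I f y (X y)) =ᶠ[𝓝 x]
      (fun p => fderiv ℝ (f ∘ (extChartAt I x).symm) p (chartField X x p)) ∘ extChartAt I x := by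
  have h2 : (2 : WithTop ℕ∞) ≤ ∞ := by norm_cast
  have : IsManifold I 2 M := IsManifold.of_le (n := ∞) h2
  have hev := (contMDiffAt_iff_contMDiffAt_nhds (by simp)).1 hf
  filter_upwards [hev, extChartAt_source_mem_nhds (I := I) x] with y hy hyc
  have hyc' : y ∈ (chartAt H x).source := by simpa using hyc
  have heq : f =ᶠ[𝓝 y] (f ∘ (extChartAt I x).symm) ∘ extChartAt I x := by
    filter_upwards [(isOpen_extChartAt_source x).mem_nhds hyc] with z hz
    simp only [Function.comp_apply, (extChartAt I x).left_inv hz]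
  have hg : DifferentiableAt ℝ (f ∘ (extChartAt I x).symm) (extChartAt I x y) :=
    (contDiffAt_comp_extChartAt_symm h2 hy hyc).differentiableAt (by norm_num)
  rw [mvfderiv_congr heq, mvfderiv_comp_fderiv hg (mdifferentiableAt_extChartAt hyc')]
  simp only [Function.comp_apply, chartField_extChartAt X hyc]

/-- The Lie bracket of vector fields is the commutator of the derivations that they define,
here acting on functions with values in a normed space. -/
lemma mvfderiv_mlieBracket [CompleteSpace E] [I.Boundaryless] {f : M → F} {x : M}
    (hf : ContMDiffAt I 𝓘(ℝ, F) 2 f x) {X Y : Π y : M, TangentSpace I y}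
    (hX : MDifferentiableAt I I.tangent (fun y => (⟨y, X y⟩ : TangentBundle I M)) x)
    (hY : MDifferentiableAt I I.tangent (fun y => (⟨y, Y y⟩ : TangentBundle I M)) x) :
    mvfderiv I f x (VectorField.mlieBracket I X Y x) =
      mvfderiv I (fun y => mvfderiv I f y (Y y)) x (X x)
        - mvfderiv I (fun y => mvfderiv I f y (X y)) x (Y x) := by
  have hx := mem_extChartAt_source (I := I) x
  have hf' : ContDiffAt ℝ 2 (f ∘ (extChartAt I x).symm) (extChartAt I x x) :=
    contDiffAt_comp_extChartAt_symm (by norm_cast) hf hx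
  have hdf : DifferentiableAt ℝ (fderiv ℝ (f ∘ (extChartAt I x).symm)) (extChartAt I x x) :=
    (hf'.fderiv_right (m := 1) (by norm_num)).differentiableAt (by norm_num)
  have hψ : MDifferentiableAt I 𝓘(ℝ, E) (extChartAt I x) x :=
    mdifferentiableAt_extChartAt (mem_chart_source H x)
  have key : ∀ Z W : Π y : M, TangentSpace I y,
      MDifferentiableAt I I.tangent (fun y => (⟨y, Z y⟩ : TangentBundle I M)) x →
      mvfderiv I (fun y => mvfderiv I f y (Z y)) x (W x) =
        fderiv ℝ (fderiv ℝ (f ∘ (extChartAt I x).symm)) (extChartAt I x x)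
          (chartField W x (extChartAt I x x)) (chartField Z x (extChartAt I x x)) +
        fderiv ℝ (f ∘ (extChartAt I x).symm) (extChartAt I x x)
          (fderiv ℝ (chartField Z x) (extChartAt I x x) (chartField W x (extChartAt I x x))) := by
    intro Z W hZ
    have hz := differentiableAt_chartField hZ
    rw [mvfderiv_congr (mvfderiv_eventuallyEq_chart hf Z),
      mvfderiv_comp_fderiv (hdf.clm_apply hz) hψ, fderiv_clm_apply hdf hz,
      ← chartField_extChartAt W hx]
    simp [add_comm]
  have hbr := (mvfderiv_eventuallyEq_chart hf (VectorField.mlieBracket I X Y)).self_of_nhds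
  refine hbr.trans ?_
  rw [Function.comp_apply, chartField_extChartAt _ hx, mvfderiv_extChartAt_mlieBracket,
    key Y X hY, key X Y hX, map_sub, (hf'.isSymmSndFDerivAt (by simp)).eq]
  abel

end BracketDerivation

/-! ### Sections of a bundle along a map -/

section SectionsAlong

variable {B F : Type*} {V : B → Type*} [TopologicalSpace B] [TopologicalSpace (TotalSpace F V)]
  [∀ x, TopologicalSpace (V x)] [NormedAddCommGroup F] [NormedSpace ℝ F] [FiberBundle F V]
  [∀ x, AddCommGroup (V x)] [∀ x, Module ℝ (V x)] [VectorBundle ℝ F V]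
  {HB : Type*} [TopologicalSpace HB] [ChartedSpace HB B]
  {EB : Type*} [NormedAddCommGroup EB] [NormedSpace ℝ EB] {IB : ModelWithCorners ℝ EB HB}
  {E : Type*} [NormedAddCommGroup E] [NormedSpace ℝ E]
  {H : Type*} [TopologicalSpace H] {I : ModelWithCorners ℝ E H}
  {M : Type*} [TopologicalSpace M] [ChartedSpace H M]
  {b : M → B} {v w : Π x : M, V (b x)} {f : M → ℝ} {x : M} {n : WithTop ℕ∞}

lemma eventually_mem_baseSet_of_continuousAt (hb : ContinuousAt b x) :
    ∀ᶠ y in 𝓝 x, b y ∈ (trivializationAt F V (b x)).baseSet :=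
  hb ((trivializationAt F V (b x)).open_baseSet.mem_nhds (mem_baseSet_trivializationAt F V (b x)))

lemma contMDiffAt_along_congr
    (hv : ContMDiffAt I (IB.prod 𝓘(ℝ, F)) n (fun y => TotalSpace.mk' F (b y) (v y)) x)
    (h : ∀ᶠ y in 𝓝 x, w y = v y) :
    ContMDiffAt I (IB.prod 𝓘(ℝ, F)) n (fun y => TotalSpace.mk' F (b y) (w y)) x :=
  hv.congr_of_eventuallyEq (h.mono fun y hy => by simp only [hy])

lemma mdifferentiableAt_along_congr
    (hv : MDifferentiableAt I (IB.prod 𝓘(ℝ, F)) (fun y => TotalSpace.mk' F (b y) (v y)) x)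
    (h : ∀ᶠ y in 𝓝 x, w y = v y) :
    MDifferentiableAt I (IB.prod 𝓘(ℝ, F)) (fun y => TotalSpace.mk' F (b y) (w y)) x :=
  hv.congr_of_eventuallyEq (h.mono fun y hy => by simp only [hy])

lemma contMDiffAt_along_add
    (hv : ContMDiffAt I (IB.prod 𝓘(ℝ, F)) n (fun y => TotalSpace.mk' F (b y) (v y)) x)
    (hw : ContMDiffAt I (IB.prod 𝓘(ℝ, F)) n (fun y => TotalSpace.mk' F (b y) (w y)) x) :
    ContMDiffAt I (IB.prod 𝓘(ℝ, F)) n (fun y => TotalSpace.mk' F (b y) (v y + w y)) x := by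
  rw [contMDiffAt_totalSpace] at hv hw ⊢
  refine ⟨hv.1, (hv.2.add hw.2).congr_of_eventuallyEq ?_⟩
  filter_upwards [eventually_mem_baseSet_of_continuousAt (F := F) (V := V) hv.1.continuousAt] with y hy
  exact ((trivializationAt F V (b x)).linear ℝ hy).map_add _ _

lemma contMDiffAt_along_smul (hf : ContMDiffAt I 𝓘(ℝ, ℝ) n f x)
    (hv : ContMDiffAt I (IB.prod 𝓘(ℝ, F)) n (fun y => TotalSpace.mk' F (b y) (v y)) x) :
    ContMDiffAt I (IB.prod 𝓘(ℝ, F)) n (fun y => TotalSpace.mk' F (b y) (f y • v y)) x := by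
  rw [contMDiffAt_totalSpace] at hv ⊢
  refine ⟨hv.1, (hf.smul hv.2).congr_of_eventuallyEq ?_⟩
  filter_upwards [eventually_mem_baseSet_of_continuousAt (F := F) (V := V) hv.1.continuousAt] with y hy
  exact ((trivializationAt F V (b x)).linear ℝ hy).map_smul _ _

lemma mdifferentiableAt_along_add
    (hv : MDifferentiableAt I (IB.prod 𝓘(ℝ, F)) (fun y => TotalSpace.mk' F (b y) (v y)) x)
    (hw : MDifferentiableAt I (IB.prod 𝓘(ℝ, F)) (fun y => TotalSpace.mk' F (b y) (w y)) x) :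
    MDifferentiableAt I (IB.prod 𝓘(ℝ, F)) (fun y => TotalSpace.mk' F (b y) (v y + w y)) x := by
  rw [mdifferentiableAt_totalSpace] at hv hw ⊢
  refine ⟨hv.1, (hv.2.add hw.2).congr_of_eventuallyEq ?_⟩
  filter_upwards [eventually_mem_baseSet_of_continuousAt (F := F) (V := V) hv.1.continuousAt] with y hy
  exact ((trivializationAt F V (b x)).linear ℝ hy).map_add _ _

lemma mdifferentiableAt_along_smul (hf : MDifferentiableAt I 𝓘(ℝ, ℝ) f x)
    (hv : MDifferentiableAt I (IB.prod 𝓘(ℝ, F)) (fun y => TotalSpace.mk' F (b y) (v y)) x) :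
    MDifferentiableAt I (IB.prod 𝓘(ℝ, F)) (fun y => TotalSpace.mk' F (b y) (f y • v y)) x := by
  rw [mdifferentiableAt_totalSpace] at hv ⊢
  refine ⟨hv.1, (hf.smul hv.2).congr_of_eventuallyEq ?_⟩
  filter_upwards [eventually_mem_baseSet_of_continuousAt (F := F) (V := V) hv.1.continuousAt] with y hy
  exact ((trivializationAt F V (b x)).linear ℝ hy).map_smul _ _

end SectionsAlong

/-! ### Vector fields and covariant derivatives -/

section Fields

variable {E : Type*} [NormedAddCommGroup E] [NormedSpace ℝ E] [FiniteDimensional ℝ E]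
  {H : Type*} [TopologicalSpace H] {I : ModelWithCorners ℝ E H}
  {M : Type*} [TopologicalSpace M] [ChartedSpace H M] [IsManifold I ∞ M]
  {X Y : Π x : M, TangentSpace I x} {f : M → ℝ} {x : M}

lemma SmoothAt.diffAt (hX : SmoothAt I X x) : DiffAt I X x :=
  ContMDiffAt.mdifferentiableAt hX (by simp)

lemma SmoothAt.eventually_diffAt (hX : SmoothAt I X x) : ∀ᶠ y in 𝓝 x, DiffAt I X y := by
  have h1 : ContMDiffAt I I.tangent 1 (fun y => (⟨y, X y⟩ : TangentBundle I M)) x :=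
    ContMDiffAt.of_le hX (by norm_cast)
  have : IsManifold I.tangent 1 (TangentBundle I M) := inferInstance
  filter_upwards [(contMDiffAt_iff_contMDiffAt_nhds (by simp)).1 h1] with y hy
  exact ContMDiffAt.mdifferentiableAt hy (by simp)

lemma smoothAt_extend (u : TangentSpace I x) : SmoothAt I (FiberBundle.extend E u) x :=
  FiberBundle.contMDiffAt_extend I E u

lemma SmoothAt.add (hX : SmoothAt I X x) (hY : SmoothAt I Y x) :
    SmoothAt I (fun y => X y + Y y) x :=
  contMDiffAt_along_add (b := fun y : M => y) hX hY

lemma SmoothAt.smul (hf : ContMDiffAt I 𝓘(ℝ, ℝ) ∞ f x) (hX : SmoothAt I X x) :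
    SmoothAt I (fun y => f y • X y) x :=
  contMDiffAt_along_smul (b := fun y : M => y) hf hX

lemma SmoothAt.congr (hX : SmoothAt I X x) (h : ∀ᶠ y in 𝓝 x, Y y = X y) : SmoothAt I Y x :=
  contMDiffAt_along_congr (b := fun y : M => y) hX h

lemma DiffAt.add (hX : DiffAt I X x) (hY : DiffAt I Y x) :
    DiffAt I (fun y => X y + Y y) x :=
  mdifferentiableAt_along_add (b := fun y : M => y) hX hY

lemma DiffAt.smul (hf : MDifferentiableAt I 𝓘(ℝ, ℝ) f x) (hX : DiffAt I X x) :
    DiffAt I (fun y => f y • X y) x :=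
  mdifferentiableAt_along_smul (b := fun y : M => y) hf hX

lemma DiffAt.congr (hX : DiffAt I X x) (h : ∀ᶠ y in 𝓝 x, Y y = X y) : DiffAt I Y x :=
  mdifferentiableAt_along_congr (b := fun y : M => y) hX h

lemma cov_congr {cov : CovariantDerivative I E (TangentSpace I : M → Type _)}
    (hX : DiffAt I X x) (h : ∀ᶠ y in 𝓝 x, Y y = X y) : cov Y x = cov X x :=
  cov.isCovariantDerivativeOn.congr_of_eventuallyEq (hX.congr h) hX Filter.univ_mem h

lemma cov_add {cov : CovariantDerivative I E (TangentSpace I : M → Type _)}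
    (hX : DiffAt I X x) (hY : DiffAt I Y x) : cov (fun y => X y + Y y) x = cov X x + cov Y x :=
  cov.isCovariantDerivativeOnUniv.add hX hY

lemma cov_smul {cov : CovariantDerivative I E (TangentSpace I : M → Type _)}
    (hf : MDifferentiableAt I 𝓘(ℝ, ℝ) f x) (hX : DiffAt I X x) (u : TangentSpace I x) :
    cov (fun y => f y • X y) x u = f x • cov X x u + mvfderiv I f x u • X x := by
  have h := cov.isCovariantDerivativeOnUniv.leibniz hX hf
  exact congrArg (fun T => T u) h

end Fields

/-! ### Components of a vector from its scalar products -/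

section InnerExpansion

/-- The components of `z` in a basis `e₁, e₂` by Cramer's rule for the Gram matrix, which is
invertible. -/
lemma eq_gram_combination {V : Type*} [NormedAddCommGroup V] [InnerProductSpace ℝ V]
    (hV : Module.finrank ℝ V = 2) {e₁ e₂ : V}
    (hd : inner ℝ e₁ e₁ * inner ℝ e₂ e₂ - inner ℝ e₁ e₂ * inner ℝ e₁ e₂ ≠ (0 : ℝ)) (z : V) :
    z = ((inner ℝ e₁ e₁ * inner ℝ e₂ e₂ - inner ℝ e₁ e₂ * inner ℝ e₁ e₂)⁻¹ *
          (inner ℝ e₂ e₂ * inner ℝ z e₁ - inner ℝ e₁ e₂ * inner ℝ z e₂) : ℝ) • e₁ +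
        ((inner ℝ e₁ e₁ * inner ℝ e₂ e₂ - inner ℝ e₁ e₂ * inner ℝ e₁ e₂)⁻¹ *
          (inner ℝ e₁ e₁ * inner ℝ z e₂ - inner ℝ e₁ e₂ * inner ℝ z e₁) : ℝ) • e₂ := by
  have hli : LinearIndependent ℝ ![e₁, e₂] := by
    rw [LinearIndependent.pair_iff]
    intro s t h
    have h1 : s * inner ℝ e₁ e₁ + t * inner ℝ e₁ e₂ = (0 : ℝ) := by
      have := congrArg (fun v => (inner ℝ e₁ v : ℝ)) h
      simpa [inner_add_right, inner_smul_right] using this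
    have h2 : s * inner ℝ e₁ e₂ + t * inner ℝ e₂ e₂ = (0 : ℝ) := by
      have := congrArg (fun v => (inner ℝ e₂ v : ℝ)) h
      simpa [inner_add_right, inner_smul_right, real_inner_comm e₁ e₂] using this
    constructor
    · exact (mul_eq_zero.1 (by linear_combination inner ℝ e₂ e₂ * h1 - inner ℝ e₁ e₂ * h2 :
        s * (inner ℝ e₁ e₁ * inner ℝ e₂ e₂ - inner ℝ e₁ e₂ * inner ℝ e₁ e₂) = 0)).resolve_right hd
    · exact (mul_eq_zero.1 (by linear_combination inner ℝ e₁ e₁ * h2 - inner ℝ e₁ e₂ * h1 :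
        t * (inner ℝ e₁ e₁ * inner ℝ e₂ e₂ - inner ℝ e₁ e₂ * inner ℝ e₁ e₂) = 0)).resolve_right hd
  have hspan : z ∈ Submodule.span ℝ (Set.range ![e₁, e₂]) := by
    rw [hli.span_eq_top_of_card_eq_finrank (by simp [hV])]
    trivial
  rw [Matrix.range_cons, Matrix.range_cons, Matrix.range_empty, Set.union_empty,
    Set.singleton_union, Submodule.mem_span_pair] at hspan
  obtain ⟨s, t, rfl⟩ := hspan
  simp only [inner_add_left, inner_smul_left, RCLike.conj_to_real, real_inner_comm e₁ e₂]
  set a : ℝ := inner ℝ e₁ e₁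
  set b : ℝ := inner ℝ e₁ e₂
  set c : ℝ := inner ℝ e₂ e₂
  congr 2
  · rw [eq_inv_mul_iff_mul_eq₀ hd]
    ring
  · rw [eq_inv_mul_iff_mul_eq₀ hd]
    ring

end InnerExpansion

/-! ### Fields along a map and their tangential and normal parts -/

section Surfaces

variable {M : Type*} [TopologicalSpace M] [ChartedSpace (EuclideanSpace ℝ (Fin 2)) M]
  [IsManifold (𝓡 2) ∞ M]
  {N : Type*} [TopologicalSpace N] [ChartedSpace (EuclideanSpace ℝ (Fin 4)) N]
  [IsManifold (𝓡 4) ∞ N] {φ : M → N} {V W : FieldAlong φ} {f : M → ℝ} {x : M}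

lemma SmoothAlongAt.diffAlongAt (hV : SmoothAlongAt φ V x) : DiffAlongAt φ V x :=
  ContMDiffAt.mdifferentiableAt hV (by simp)

lemma SmoothAlongAt.eventually_diffAlongAt (hV : SmoothAlongAt φ V x) :
    ∀ᶠ y in 𝓝 x, DiffAlongAt φ V y := by
  have h1 : ContMDiffAt (𝓡 2) (𝓡 4).tangent 1
      (fun y => (⟨φ y, V y⟩ : TangentBundle (𝓡 4) N)) x :=
    ContMDiffAt.of_le hV (by norm_cast)
  filter_upwards [(contMDiffAt_iff_contMDiffAt_nhds (by simp)).1 h1] with y hy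
  exact ContMDiffAt.mdifferentiableAt hy (by simp)

lemma SmoothAlongAt.add (hV : SmoothAlongAt φ V x) (hW : SmoothAlongAt φ W x) :
    SmoothAlongAt φ (fun y => V y + W y) x :=
  contMDiffAt_along_add hV hW

lemma SmoothAlongAt.smul (hf : ContMDiffAt (𝓡 2) 𝓘(ℝ, ℝ) ∞ f x) (hV : SmoothAlongAt φ V x) :
    SmoothAlongAt φ (fun y => f y • V y) x :=
  contMDiffAt_along_smul hf hV

lemma SmoothAlongAt.sub (hV : SmoothAlongAt φ V x) (hW : SmoothAlongAt φ W x) :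
    SmoothAlongAt φ (fun y => V y - W y) x := by
  simpa [sub_eq_add_neg] using hV.add (hW.smul (f := fun _ => (-1 : ℝ)) contMDiffAt_const)

lemma SmoothAlongAt.congr (hV : SmoothAlongAt φ V x) (h : ∀ᶠ y in 𝓝 x, W y = V y) :
    SmoothAlongAt φ W x :=
  contMDiffAt_along_congr hV h

lemma DiffAlongAt.add (hV : DiffAlongAt φ V x) (hW : DiffAlongAt φ W x) :
    DiffAlongAt φ (fun y => V y + W y) x :=
  mdifferentiableAt_along_add hV hW

lemma DiffAlongAt.smul (hf : MDifferentiableAt (𝓡 2) 𝓘(ℝ, ℝ) f x) (hV : DiffAlongAt φ V x) :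
    DiffAlongAt φ (fun y => f y • V y) x :=
  mdifferentiableAt_along_smul hf hV

lemma DiffAlongAt.sub (hV : DiffAlongAt φ V x) (hW : DiffAlongAt φ W x) :
    DiffAlongAt φ (fun y => V y - W y) x := by
  simpa [sub_eq_add_neg] using hV.add (hW.smul (f := fun _ => (-1 : ℝ)) mdifferentiableAt_const)

lemma DiffAlongAt.congr (hV : DiffAlongAt φ V x) (h : ∀ᶠ y in 𝓝 x, W y = V y) :
    DiffAlongAt φ W x :=
  mdifferentiableAt_along_congr hV h

lemma SmoothAt.smoothAlongAt_comp (hφ : ContMDiffAt (𝓡 2) (𝓡 4) ∞ φ x)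
    {Z : Π y : N, TangentSpace (𝓡 4) y} (hZ : SmoothAt (𝓡 4) Z (φ x)) :
    SmoothAlongAt φ (fun y => Z (φ y)) x :=
  ContMDiffAt.comp x hZ hφ

lemma DiffAt.diffAlongAt_comp (hφ : MDifferentiableAt (𝓡 2) (𝓡 4) φ x)
    {Z : Π y : N, TangentSpace (𝓡 4) y} (hZ : DiffAt (𝓡 4) Z (φ x)) :
    DiffAlongAt φ (fun y => Z (φ y)) x :=
  MDifferentiableAt.comp x hZ hφ

lemma smoothAlongAt_dmap (hφ : ContMDiff (𝓡 2) (𝓡 4) ∞ φ) {Y : Π x : M, TangentSpace (𝓡 2) x}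
    (hY : SmoothAt (𝓡 2) Y x) : SmoothAlongAt φ (fun y => dmap φ y (Y y)) x :=
  ContMDiffAt.comp x (hφ.contMDiff_tangentMap (m := ∞) (by simp)).contMDiffAt hY

lemma diffAlongAt_dmap (hφ : ContMDiff (𝓡 2) (𝓡 4) ∞ φ) {Y : Π x : M, TangentSpace (𝓡 2) x}
    (hY : DiffAt (𝓡 2) Y x) : DiffAlongAt φ (fun y => dmap φ y (Y y)) x :=
  MDifferentiableAt.comp x
    ((hφ.contMDiff_tangentMap (m := ∞) (by simp)).contMDiffAt.mdifferentiableAt (by simp)) hY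

/-- The endomorphism field `J` of `TN` is smooth. -/
abbrev SmoothEnd (J : Π y : N, TangentSpace (𝓡 4) y →L[ℝ] TangentSpace (𝓡 4) y) : Prop :=
  ContMDiff (𝓡 4) ((𝓡 4).prod 𝓘(ℝ, EuclideanSpace ℝ (Fin 4) →L[ℝ] EuclideanSpace ℝ (Fin 4))) ∞
    (fun x => Bundle.TotalSpace.mk' (EuclideanSpace ℝ (Fin 4) →L[ℝ] EuclideanSpace ℝ (Fin 4))
      (E := fun x : N => TangentSpace (𝓡 4) x →L[ℝ] TangentSpace (𝓡 4) x) x (J x))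

variable {J : Π y : N, TangentSpace (𝓡 4) y →L[ℝ] TangentSpace (𝓡 4) y}

lemma SmoothAlongAt.end_apply (hJ : SmoothEnd J) (hφ : ContMDiff (𝓡 2) (𝓡 4) ∞ φ)
    (hV : SmoothAlongAt φ V x) : SmoothAlongAt φ (fun y => J (φ y) (V y)) x :=
  ContMDiffAt.clm_bundle_apply (ContMDiffAt.comp x hJ.contMDiffAt hφ.contMDiffAt) hV

lemma DiffAlongAt.end_apply (hJ : SmoothEnd J) (hφ : ContMDiff (𝓡 2) (𝓡 4) ∞ φ)
    (hV : DiffAlongAt φ V x) : DiffAlongAt φ (fun y => J (φ y) (V y)) x :=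
  MDifferentiableAt.clm_bundle_apply (MDifferentiableAt.comp x
    (hJ.contMDiffAt.mdifferentiableAt (by simp)) (hφ.contMDiffAt.mdifferentiableAt (by simp))) hV

lemma SmoothAt.end_apply (hJ : SmoothEnd J) {Z : Π y : N, TangentSpace (𝓡 4) y} {y : N}
    (hZ : SmoothAt (𝓡 4) Z y) : SmoothAt (𝓡 4) (fun y => J y (Z y)) y :=
  ContMDiffAt.clm_bundle_apply (b := fun y : N => y) hJ.contMDiffAt hZ

lemma DiffAt.end_apply (hJ : SmoothEnd J) {Z : Π y : N, TangentSpace (𝓡 4) y} {y : N}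
    (hZ : DiffAt (𝓡 4) Z y) : DiffAt (𝓡 4) (fun y => J y (Z y)) y :=
  MDifferentiableAt.clm_bundle_apply (b := fun y : N => y)
    (hJ.contMDiffAt.mdifferentiableAt (by simp)) hZ

lemma inner_tangentialPart [RiemannianBundle (fun x : M => TangentSpace (𝓡 2) x)]
    [RiemannianBundle (fun y : N => TangentSpace (𝓡 4) y)]
    (w : TangentSpace (𝓡 4) (φ x)) (u : TangentSpace (𝓡 2) x) :
    inner ℝ (tangentialPart φ x w) u = inner ℝ w (dmap φ x u) :=
  LinearMap.adjoint_inner_left _ _ _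

section AmbientMetric

variable [RiemannianBundle (fun y : N => TangentSpace (𝓡 4) y)]
  [IsContMDiffRiemannianBundle (𝓡 4) ∞ (EuclideanSpace ℝ (Fin 4))
      (fun y : N => TangentSpace (𝓡 4) y)]

lemma SmoothAlongAt.inner (hV : SmoothAlongAt φ V x) (hW : SmoothAlongAt φ W x) :
    ContMDiffAt (𝓡 2) 𝓘(ℝ, ℝ) ∞ (fun y => (inner ℝ (V y) (W y) : ℝ)) x :=
  ContMDiffAt.inner_bundle (E := fun x : N => TangentSpace (𝓡 4) x) hV hW

lemma DiffAlongAt.inner (hV : DiffAlongAt φ V x) (hW : DiffAlongAt φ W x) :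
    MDifferentiableAt (𝓡 2) 𝓘(ℝ, ℝ) (fun y => (inner ℝ (V y) (W y) : ℝ)) x :=
  have : IsContMDiffRiemannianBundle (𝓡 4) 1 (EuclideanSpace ℝ (Fin 4))
      (fun y : N => TangentSpace (𝓡 4) y) :=
    IsContMDiffRiemannianBundle.of_le (n := ∞) (by norm_cast)
  MDifferentiableAt.inner_bundle (IB := 𝓡 4) (E := fun x : N => TangentSpace (𝓡 4) x) hV hW

end AmbientMetric

variable [RiemannianBundle (fun x : M => TangentSpace (𝓡 2) x)]
  [IsContMDiffRiemannianBundle (𝓡 2) ∞ (EuclideanSpace ℝ (Fin 2))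
      (fun x : M => TangentSpace (𝓡 2) x)]

lemma SmoothAt.inner {X Y : Π x : M, TangentSpace (𝓡 2) x}
    (hX : SmoothAt (𝓡 2) X x) (hY : SmoothAt (𝓡 2) Y x) :
    ContMDiffAt (𝓡 2) 𝓘(ℝ, ℝ) ∞ (fun y => (inner ℝ (X y) (Y y) : ℝ)) x :=
  ContMDiffAt.inner_bundle (E := fun x : M => TangentSpace (𝓡 2) x) (b := fun y : M => y) hX hY

/-- Near `x` there is a smooth frame in which the components of each vector field are smooth
combinations of its scalar products with the frame. -/
lemma exists_smooth_gram_expansion (x : M) :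
    ∃ e₁ e₂ : Π x : M, TangentSpace (𝓡 2) x, ∃ g₁₁ g₁₂ g₂₂ d : M → ℝ,
      SmoothAt (𝓡 2) e₁ x ∧ SmoothAt (𝓡 2) e₂ x ∧
      ContMDiffAt (𝓡 2) 𝓘(ℝ, ℝ) ∞ g₁₁ x ∧ ContMDiffAt (𝓡 2) 𝓘(ℝ, ℝ) ∞ g₁₂ x ∧
      ContMDiffAt (𝓡 2) 𝓘(ℝ, ℝ) ∞ g₂₂ x ∧ ContMDiffAt (𝓡 2) 𝓘(ℝ, ℝ) ∞ d x ∧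
      ∀ Z : Π x : M, TangentSpace (𝓡 2) x, ∀ᶠ y in 𝓝 x,
        Z y = (d y * (g₂₂ y * inner ℝ (Z y) (e₁ y) - g₁₂ y * inner ℝ (Z y) (e₂ y))) • e₁ y +
          (d y * (g₁₁ y * inner ℝ (Z y) (e₂ y) - g₁₂ y * inner ℝ (Z y) (e₁ y))) • e₂ y := by
  have hrank : ∀ y : M, Module.finrank ℝ (TangentSpace (𝓡 2) y) = 2 := fun y =>
    finrank_euclideanSpace_fin (𝕜 := ℝ) (n := 2)
  -- the frame extends an orthonormal basis, so that its Gram determinant is 1 at `x`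
  let o : OrthonormalBasis (Fin 2) ℝ (TangentSpace (𝓡 2) x) :=
    (stdOrthonormalBasis ℝ (TangentSpace (𝓡 2) x)).reindex (finCongr (hrank x))
  let e₁ : Π x : M, TangentSpace (𝓡 2) x := FiberBundle.extend (EuclideanSpace ℝ (Fin 2)) (o 0)
  let e₂ : Π x : M, TangentSpace (𝓡 2) x := FiberBundle.extend (EuclideanSpace ℝ (Fin 2)) (o 1)
  have h₁ : SmoothAt (𝓡 2) e₁ x := smoothAt_extend _
  have h₂ : SmoothAt (𝓡 2) e₂ x := smoothAt_extend _
  have hD : ContMDiffAt (𝓡 2) 𝓘(ℝ, ℝ) ∞ (fun y => (inner ℝ (e₁ y) (e₁ y) * inner ℝ (e₂ y) (e₂ y)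
      - inner ℝ (e₁ y) (e₂ y) * inner ℝ (e₁ y) (e₂ y) : ℝ)) x :=
    ((h₁.inner h₁).mul (h₂.inner h₂)).sub ((h₁.inner h₂).mul (h₁.inner h₂))
  have hDx : (inner ℝ (e₁ x) (e₁ x) * inner ℝ (e₂ x) (e₂ x)
      - inner ℝ (e₁ x) (e₂ x) * inner ℝ (e₁ x) (e₂ x) : ℝ) ≠ 0 := by
    have h01 : inner ℝ (o 0) (o 1) = (0 : ℝ) := o.orthonormal.2 (by decide)
    simp [e₁, e₂, h01]
  refine ⟨e₁, e₂, _, _, _, _, h₁, h₂, h₁.inner h₁, h₁.inner h₂, h₂.inner h₂, hD.inv₀ hDx, ?_⟩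
  intro Z
  filter_upwards [hD.continuousAt.eventually_ne hDx] with y hy
  exact eq_gram_combination (hrank y) hy (Z y)

/-- A vector field is smooth as soon as its scalar products with smooth vector fields are. -/
lemma smoothAt_of_inner {Z : Π x : M, TangentSpace (𝓡 2) x}
    (h : ∀ Y : Π x : M, TangentSpace (𝓡 2) x, SmoothAt (𝓡 2) Y x →
      ContMDiffAt (𝓡 2) 𝓘(ℝ, ℝ) ∞ (fun y => (inner ℝ (Z y) (Y y) : ℝ)) x) :
    SmoothAt (𝓡 2) Z x := by
  obtain ⟨e₁, e₂, g₁₁, g₁₂, g₂₂, d, h₁, h₂, h₁₁, h₁₂, h₂₂, hd, hZ⟩ := exists_smooth_gram_expansion x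
  refine SmoothAt.congr ?_ (hZ Z)
  exact (SmoothAt.smul (hd.mul ((h₂₂.mul (h e₁ h₁)).sub (h₁₂.mul (h e₂ h₂)))) h₁).add
    (SmoothAt.smul (hd.mul ((h₁₁.mul (h e₂ h₂)).sub (h₁₂.mul (h e₁ h₁)))) h₂)

/-- A vector field is differentiable as soon as its scalar products with smooth vector fields
are. -/
lemma diffAt_of_inner {Z : Π x : M, TangentSpace (𝓡 2) x}
    (h : ∀ Y : Π x : M, TangentSpace (𝓡 2) x, SmoothAt (𝓡 2) Y x →
      MDifferentiableAt (𝓡 2) 𝓘(ℝ, ℝ) (fun y => (inner ℝ (Z y) (Y y) : ℝ)) x) :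
    DiffAt (𝓡 2) Z x := by
  obtain ⟨e₁, e₂, g₁₁, g₁₂, g₂₂, d, h₁, h₂, h₁₁, h₁₂, h₂₂, hd, hZ⟩ := exists_smooth_gram_expansion x
  refine DiffAt.congr ?_ (hZ Z)
  have a₁₁ := h₁₁.mdifferentiableAt (by simp)
  have a₁₂ := h₁₂.mdifferentiableAt (by simp)
  have a₂₂ := h₂₂.mdifferentiableAt (by simp)
  have ad := hd.mdifferentiableAt (by simp)
  exact (DiffAt.smul (ad.mul ((a₂₂.mul (h e₁ h₁)).sub (a₁₂.mul (h e₂ h₂)))) h₁.diffAt).add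
    (DiffAt.smul (ad.mul ((a₁₁.mul (h e₂ h₂)).sub (a₁₂.mul (h e₁ h₁)))) h₂.diffAt)

variable [RiemannianBundle (fun y : N => TangentSpace (𝓡 4) y)]
variable [IsContMDiffRiemannianBundle (𝓡 4) ∞ (EuclideanSpace ℝ (Fin 4))
      (fun y : N => TangentSpace (𝓡 4) y)]

lemma smoothAt_tangentialPart (hφ : ContMDiff (𝓡 2) (𝓡 4) ∞ φ) (hV : SmoothAlongAt φ V x) :
    SmoothAt (𝓡 2) (fun y => tangentialPart φ y (V y)) x :=
  smoothAt_of_inner fun Y hY => by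
    simpa only [inner_tangentialPart] using hV.inner (smoothAlongAt_dmap hφ hY)

lemma diffAt_tangentialPart (hφ : ContMDiff (𝓡 2) (𝓡 4) ∞ φ) (hV : DiffAlongAt φ V x) :
    DiffAt (𝓡 2) (fun y => tangentialPart φ y (V y)) x :=
  diffAt_of_inner fun Y hY => by
    simpa only [inner_tangentialPart] using hV.inner (smoothAlongAt_dmap hφ hY).diffAlongAt

lemma smoothAlongAt_normalPart (hφ : ContMDiff (𝓡 2) (𝓡 4) ∞ φ) (hV : SmoothAlongAt φ V x) :
    SmoothAlongAt φ (fun y => normalPart φ y (V y)) x :=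
  hV.sub (smoothAlongAt_dmap hφ (smoothAt_tangentialPart hφ hV))

lemma diffAlongAt_normalPart (hφ : ContMDiff (𝓡 2) (𝓡 4) ∞ φ) (hV : DiffAlongAt φ V x) :
    DiffAlongAt φ (fun y => normalPart φ y (V y)) x :=
  hV.sub (diffAlongAt_dmap hφ (diffAt_tangentialPart hφ hV))

end Surfaces

/-! ### Curvature of metric connections -/

section MetricCurvature

variable {E : Type*} [NormedAddCommGroup E] [NormedSpace ℝ E] [CompleteSpace E]
  {H : Type*} [TopologicalSpace H] {I : ModelWithCorners ℝ E H} [I.Boundaryless]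
  {M : Type*} [TopologicalSpace M] [ChartedSpace H M] [IsManifold I ∞ M]
  {V : M → Type*} [∀ x, NormedAddCommGroup (V x)] [∀ x, InnerProductSpace ℝ (V x)]

/-- The curvature `∇_X ∇_Y Z - ∇_Y ∇_X Z - ∇_{[X,Y]} Z`, at a point, of an operator `∇` which
differentiates the sections of a family of vector spaces over `M` in the directions tangent
to `M`. -/
def sectionCurvature (nabla : (Π x : M, V x) → Π x : M, TangentSpace I x → V x)
    (X Y : Π x : M, TangentSpace I x) (Z : Π x : M, V x) (x : M) : V x :=
  nabla (fun y => nabla Z y (Y y)) x (X x) - nabla (fun y => nabla Z y (X y)) x (Y x)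
    - nabla Z x (VectorField.mlieBracket I X Y x)

/-- The curvature of a metric connection is skew-symmetric: this is `XYf - YXf - [X,Y]f = 0` for
`f = ⟨Z,W⟩`. Here `D Z x` stands for the differentiability of the section `Z` at `x`. -/
lemma inner_sectionCurvature_skew {nabla : (Π x : M, V x) → Π x : M, TangentSpace I x → V x}
    {D : (Π x : M, V x) → M → Prop}
    (hD : ∀ (Z W : Π x : M, V x) (x : M), D Z x → D W x →
      MDifferentiableAt I 𝓘(ℝ, ℝ) (fun y => (inner ℝ (Z y) (W y) : ℝ)) x)
    (hmetric : ∀ (Z W : Π x : M, V x) (x : M), D Z x → D W x → ∀ u : TangentSpace I x,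
      mvfderiv I (fun y => (inner ℝ (Z y) (W y) : ℝ)) x u =
        inner ℝ (nabla Z x u) (W x) + inner ℝ (Z x) (nabla W x u))
    {X Y : Π x : M, TangentSpace I x} {x : M}
    (hX : MDifferentiableAt I I.tangent (fun y => (⟨y, X y⟩ : TangentBundle I M)) x)
    (hY : MDifferentiableAt I I.tangent (fun y => (⟨y, Y y⟩ : TangentBundle I M)) x)
    {Z W : Π x : M, V x} (hZ : ∀ᶠ y in 𝓝 x, D Z y) (hW : ∀ᶠ y in 𝓝 x, D W y)
    (hZX : D (fun y => nabla Z y (X y)) x) (hZY : D (fun y => nabla Z y (Y y)) x)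
    (hWX : D (fun y => nabla W y (X y)) x) (hWY : D (fun y => nabla W y (Y y)) x)
    (hf : ContMDiffAt I 𝓘(ℝ, ℝ) 2 (fun y => (inner ℝ (Z y) (W y) : ℝ)) x) :
    inner ℝ (sectionCurvature nabla X Y Z x) (W x) +
      inner ℝ (Z x) (sectionCurvature nabla X Y W x) = (0 : ℝ) := by
  have key : ∀ T S : Π x : M, TangentSpace I x, D (fun y => nabla Z y (T y)) x →
      D (fun y => nabla W y (T y)) x →
      mvfderiv I (fun y => mvfderiv I (fun y => (inner ℝ (Z y) (W y) : ℝ)) y (T y)) x (S x) =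
        inner ℝ (nabla (fun y => nabla Z y (T y)) x (S x)) (W x)
          + inner ℝ (nabla Z x (T x)) (nabla W x (S x))
          + (inner ℝ (nabla Z x (S x)) (nabla W x (T x))
          + inner ℝ (Z x) (nabla (fun y => nabla W y (T y)) x (S x))) := by
    intro T S hZT hWT
    have heq : (fun y => mvfderiv I (fun y => (inner ℝ (Z y) (W y) : ℝ)) y (T y)) =ᶠ[𝓝 x]
        fun y => (inner ℝ (nabla Z y (T y)) (W y) : ℝ) + inner ℝ (Z y) (nabla W y (T y)) := by
      filter_upwards [hZ, hW] with y hy hy'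
      exact hmetric Z W y hy hy' (T y)
    rw [mvfderiv_congr heq, mvfderiv_fun_add (hD _ _ _ hZT hW.self_of_nhds)
      (hD _ _ _ hZ.self_of_nhds hWT), add_apply, hmetric _ _ x hZT hW.self_of_nhds,
      hmetric _ _ x hZ.self_of_nhds hWT]
  have h := mvfderiv_mlieBracket hf hX hY
  rw [hmetric _ _ x hZ.self_of_nhds hW.self_of_nhds, key Y X hZY hWY, key X Y hZX hWX] at h
  simp only [sectionCurvature, inner_sub_left, inner_sub_right]
  linarith

end MetricCurvature

/-! ### The curvature tensor of a Kaehler manifold -/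

section Ambient

variable {N : Type*} [TopologicalSpace N] [ChartedSpace (EuclideanSpace ℝ (Fin 4)) N]
  [IsManifold (𝓡 4) ∞ N] [RiemannianBundle (fun y : N => TangentSpace (𝓡 4) y)]
  [IsContMDiffRiemannianBundle (𝓡 4) ∞ (EuclideanSpace ℝ (Fin 4))
      (fun y : N => TangentSpace (𝓡 4) y)]
  {cov : CovariantDerivative (𝓡 4) (EuclideanSpace ℝ (Fin 4)) (TangentSpace (𝓡 4) : N → Type _)}
  {J : Π y : N, TangentSpace (𝓡 4) y →L[ℝ] TangentSpace (𝓡 4) y}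
  {X Y Z W : Π y : N, TangentSpace (𝓡 4) y} {x : N}

lemma inner_curvature_skew (h : IsLeviCivita cov) (hX : SmoothAt (𝓡 4) X x)
    (hY : SmoothAt (𝓡 4) Y x) (hZ : SmoothAt (𝓡 4) Z x) (hW : SmoothAt (𝓡 4) W x) :
    inner ℝ (curvature cov X Y Z x) (W x) + inner ℝ (Z x) (curvature cov X Y W x) = (0 : ℝ) := by
  have h1 : IsContMDiffRiemannianBundle (𝓡 4) 1 (EuclideanSpace ℝ (Fin 4))
      (fun y : N => TangentSpace (𝓡 4) y) :=
    IsContMDiffRiemannianBundle.of_le (n := ∞) (by norm_cast)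
  exact inner_sectionCurvature_skew (nabla := fun Z y u => cov Z y u) (D := DiffAt (𝓡 4))
    (fun Z W y hZ hW => MDifferentiableAt.inner_bundle (IB := 𝓡 4)
      (E := fun y : N => TangentSpace (𝓡 4) y) (b := fun y : N => y) hZ hW)
    h.metric hX.diffAt hY.diffAt hZ.eventually_diffAt hW.eventually_diffAt
    (h.smooth X Z x hX hZ).diffAt (h.smooth Y Z x hY hZ).diffAt
    (h.smooth X W x hX hW).diffAt (h.smooth Y W x hY hW).diffAt
    ((ContMDiffAt.inner_bundle (IB := 𝓡 4) (E := fun y : N => TangentSpace (𝓡 4) y)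
      (b := fun y : N => y) hZ hW).of_le (by norm_cast))

/-- The curvature of a metric connection depends on the differentiated field only through its
value at the point, because it is skew-symmetric. -/
lemma curvature_congr (h : IsLeviCivita cov) (hX : SmoothAt (𝓡 4) X x)
    (hY : SmoothAt (𝓡 4) Y x) (hZ : SmoothAt (𝓡 4) Z x) (hW : SmoothAt (𝓡 4) W x)
    (hZW : Z x = W x) : curvature cov X Y Z x = curvature cov X Y W x := by
  refine ext_inner_right ℝ fun v => ?_
  have hv := smoothAt_extend (I := 𝓡 4) v
  have h1 := inner_curvature_skew h hX hY hZ hv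
  have h2 := inner_curvature_skew h hX hY hW hv
  rw [FiberBundle.extend_apply_self] at h1 h2
  rw [hZW] at h1
  linarith

lemma inner_curvatureTensor_skew (h : IsLeviCivita cov) (u v w w' : TangentSpace (𝓡 4) x) :
    inner ℝ (curvatureTensor cov x u v w) w' + inner ℝ w (curvatureTensor cov x u v w')
      = (0 : ℝ) := by
  have h1 := inner_curvature_skew h (smoothAt_extend u) (smoothAt_extend v) (smoothAt_extend w)
    (smoothAt_extend w')
  rwa [FiberBundle.extend_apply_self, FiberBundle.extend_apply_self] at h1

/-- A Kaehler structure is parallel, hence commutes with the curvature. -/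
lemma curvatureTensor_end_apply (h : IsKaehler cov J) (u v w : TangentSpace (𝓡 4) x) :
    curvatureTensor cov x u v (J x w) = J x (curvatureTensor cov x u v w) := by
  have hu := smoothAt_extend (I := 𝓡 4) u
  have hv := smoothAt_extend (I := 𝓡 4) v
  have hw := smoothAt_extend (I := 𝓡 4) w
  have key : ∀ S T : Π y : N, TangentSpace (𝓡 4) y, SmoothAt (𝓡 4) S x →
      cov (fun y => cov (fun y => J y (FiberBundle.extend (EuclideanSpace ℝ (Fin 4)) w y)) y (S y))
        x (T x) =
      J x (cov (fun y => cov (FiberBundle.extend (EuclideanSpace ℝ (Fin 4)) w) y (S y)) x (T x)) := by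
    intro S T hS
    have hd := (h.leviCivita.smooth S _ x hS hw).diffAt
    have heq : ∀ᶠ y in 𝓝 x,
        cov (fun y => J y (FiberBundle.extend (EuclideanSpace ℝ (Fin 4)) w y)) y (S y) =
        J y (cov (FiberBundle.extend (EuclideanSpace ℝ (Fin 4)) w) y (S y)) := by
      filter_upwards [hw.eventually_diffAt] with y hy
      exact h.parallel _ y hy _
    rw [cov_congr (hd.end_apply h.smooth) heq, h.parallel _ x hd]
  calc curvatureTensor cov x u v (J x w)
      = curvature cov (FiberBundle.extend _ u) (FiberBundle.extend _ v)
          (fun y => J y (FiberBundle.extend (EuclideanSpace ℝ (Fin 4)) w y)) x :=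
        curvature_congr h.leviCivita hu hv (smoothAt_extend _) (hw.end_apply h.smooth) (by simp)
    _ = J x (curvatureTensor cov x u v w) := by
        rw [curvatureTensor, curvature, curvature, key _ _ hv, key _ _ hu,
          h.parallel _ x hw.diffAt, map_sub, map_sub]

end Ambient

/-! ### Skew-symmetric operators commuting with a complex structure -/

section PurelyReal

variable {V : Type*} [NormedAddCommGroup V] [InnerProductSpace ℝ V]

/-- A skew-symmetric operator whose values on `P` and on `Pᗮ` lie in `P` vanishes if it commutes
with a complex structure `J` such that `J P ⊓ P = 0`: it kills `Pᗮ`, so that its image is a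
`J`-invariant subset of `P`. -/
lemma eq_zero_of_skew_of_commute {Δ J : V → V} {P : Set V} (hJ : ∀ v, J (J v) = -v)
    (hJ0 : J 0 = 0) (hP : ∀ v ∈ P, J v ∈ P → J v = 0)
    (hadd : ∀ v w, v ∈ P → w ∈ P → v + w ∈ P)
    (hskew : ∀ v w, inner ℝ (Δ v) w + inner ℝ v (Δ w) = (0 : ℝ)) (hcomm : ∀ v, Δ (J v) = J (Δ v))
    (htop : ∀ v ∈ P, Δ v ∈ P) (hbot : ∀ w, (∀ v ∈ P, inner ℝ v w = (0 : ℝ)) → Δ w ∈ P)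
    (hsplit : ∀ v, ∃ p ∈ P, ∃ q, (∀ v ∈ P, inner ℝ v q = (0 : ℝ)) ∧ p + q = v) (v : V) :
    Δ v = 0 := by
  have hΔadd : ∀ v w, Δ (v + w) = Δ v + Δ w := by
    intro v w
    refine ext_inner_right ℝ fun z => ?_
    have h1 := hskew (v + w) z
    have h2 := hskew v z
    have h3 := hskew w z
    rw [inner_add_left] at h1 ⊢
    linarith
  have hmem : ∀ v, Δ v ∈ P := by
    intro v
    obtain ⟨p, hp, q, hq, rfl⟩ := hsplit v
    rw [hΔadd]
    exact hadd _ _ (htop p hp) (hbot q hq)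
  have h0 : J (Δ v) = 0 := hP _ (hmem v) (hcomm v ▸ hmem (J v))
  have h1 := hJ (Δ v)
  rw [h0, hJ0] at h1
  exact neg_eq_zero.1 h1.symm

end PurelyReal

/-! ### The connection assembled from admissible data -/

section Surfaces

variable {M : Type*} [TopologicalSpace M] [ChartedSpace (EuclideanSpace ℝ (Fin 2)) M]
  [IsManifold (𝓡 2) ∞ M]
  {N : Type*} [TopologicalSpace N] [ChartedSpace (EuclideanSpace ℝ (Fin 4)) N]
  [IsManifold (𝓡 4) ∞ N] {φ : M → N} {x : M}
  [RiemannianBundle (fun x : M => TangentSpace (𝓡 2) x)]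
  [RiemannianBundle (fun y : N => TangentSpace (𝓡 4) y)]

lemma tangentialPart_dmap (hφ : IsIsometricImmersion φ) (u : TangentSpace (𝓡 2) x) :
    tangentialPart φ x (dmap φ x u) = u :=
  ext_inner_right ℝ fun v => by rw [inner_tangentialPart, hφ.isometric]

lemma mem_normalSpace_iff {w : TangentSpace (𝓡 4) (φ x)} :
    w ∈ normalSpace φ x ↔ ∀ u, inner ℝ (dmap φ x u) w = (0 : ℝ) := by
  rw [normalSpace, Submodule.mem_orthogonal]
  constructor
  · intro h u
    exact h _ ⟨u, rfl⟩
  · rintro h _ ⟨u, rfl⟩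
    exact h u

lemma tangentialPart_eq_zero_iff {w : TangentSpace (𝓡 4) (φ x)} :
    tangentialPart φ x w = 0 ↔ w ∈ normalSpace φ x := by
  rw [mem_normalSpace_iff]
  constructor
  · intro h u
    rw [real_inner_comm, ← inner_tangentialPart, h, inner_zero_left]
  · intro h
    refine ext_inner_right ℝ fun u => ?_
    rw [inner_tangentialPart, real_inner_comm, h, inner_zero_left]

lemma normalPart_mem (hφ : IsIsometricImmersion φ) (w : TangentSpace (𝓡 4) (φ x)) :
    normalPart φ x w ∈ normalSpace φ x := by
  rw [← tangentialPart_eq_zero_iff, normalPart, map_sub, tangentialPart_dmap hφ, sub_self]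

lemma normalPart_of_mem {w : TangentSpace (𝓡 4) (φ x)} (hw : w ∈ normalSpace φ x) :
    normalPart φ x w = w := by
  rw [normalPart, tangentialPart_eq_zero_iff.2 hw, map_zero, sub_zero]

lemma normalPart_dmap (hφ : IsIsometricImmersion φ) (u : TangentSpace (𝓡 2) x) :
    normalPart φ x (dmap φ x u) = 0 := by
  rw [normalPart, tangentialPart_dmap hφ, sub_self]

lemma dmap_tangentialPart_add_normalPart (w : TangentSpace (𝓡 4) (φ x)) :
    dmap φ x (tangentialPart φ x w) + normalPart φ x w = w := by
  rw [normalPart, add_sub_cancel]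

lemma tangentialPart_dmap_add (hφ : IsIsometricImmersion φ) (u : TangentSpace (𝓡 2) x)
    {ξ : TangentSpace (𝓡 4) (φ x)} (hξ : ξ ∈ normalSpace φ x) :
    tangentialPart φ x (dmap φ x u + ξ) = u := by
  rw [map_add, tangentialPart_dmap hφ, tangentialPart_eq_zero_iff.2 hξ, add_zero]

lemma normalPart_dmap_add (hφ : IsIsometricImmersion φ) (u : TangentSpace (𝓡 2) x)
    {ξ : TangentSpace (𝓡 4) (φ x)} (hξ : ξ ∈ normalSpace φ x) :
    normalPart φ x (dmap φ x u + ξ) = ξ := by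
  rw [normalPart, tangentialPart_dmap_add hφ u hξ, add_sub_cancel_left]

lemma inner_eq_inner_parts (hφ : IsIsometricImmersion φ) (v w : TangentSpace (𝓡 4) (φ x)) :
    (inner ℝ v w : ℝ) = inner ℝ (tangentialPart φ x v) (tangentialPart φ x w) +
      inner ℝ (normalPart φ x v) (normalPart φ x w) := by
  conv_lhs => rw [← dmap_tangentialPart_add_normalPart v, ← dmap_tangentialPart_add_normalPart w]
  have h1 := mem_normalSpace_iff.1 (normalPart_mem hφ w) (tangentialPart φ x v)
  have h2 := mem_normalSpace_iff.1 (normalPart_mem hφ v) (tangentialPart φ x w)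
  rw [real_inner_comm] at h2
  rw [inner_add_left, inner_add_right, inner_add_right, h1, h2, hφ.isometric]
  ring

lemma normalPart_sub (v w : TangentSpace (𝓡 4) (φ x)) :
    normalPart φ x (v - w) = normalPart φ x v - normalPart φ x w := by
  simp only [normalPart, map_sub]
  abel

namespace FundamentalForms

variable {s : FundamentalForms φ}
  {covM : CovariantDerivative (𝓡 2) (EuclideanSpace ℝ (Fin 2)) (TangentSpace (𝓡 2) : M → Type _)}
  {V : FieldAlong φ}

lemma connection_eq (V : FieldAlong φ) (u : TangentSpace (𝓡 2) x) :
    s.connection covM V x u =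
      dmap φ x (covM (fun y => tangentialPart φ y (V y)) x u - s.A x (normalPart φ x (V x)) u) +
      (s.h x u (tangentialPart φ x (V x)) + s.D (fun y => normalPart φ y (V y)) x u) := by
  rw [connection, map_sub]
  abel

lemma connection_normal_mem (hs : s.NormalValued) (hφ : IsIsometricImmersion φ) (V : FieldAlong φ)
    (u : TangentSpace (𝓡 2) x) :
    s.h x u (tangentialPart φ x (V x)) + s.D (fun y => normalPart φ y (V y)) x u
      ∈ normalSpace φ x :=
  Submodule.add_mem _ (hs.h_normal _ _ _) (hs.D_normal _ (fun _ => normalPart_mem hφ _) _ _)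

lemma tangentialPart_connection (hs : s.NormalValued) (hφ : IsIsometricImmersion φ)
    (V : FieldAlong φ) (u : TangentSpace (𝓡 2) x) :
    tangentialPart φ x (s.connection covM V x u) =
      covM (fun y => tangentialPart φ y (V y)) x u - s.A x (normalPart φ x (V x)) u := by
  rw [connection_eq, tangentialPart_dmap_add hφ _ (connection_normal_mem hs hφ V u)]

lemma normalPart_connection (hs : s.NormalValued) (hφ : IsIsometricImmersion φ)
    (V : FieldAlong φ) (u : TangentSpace (𝓡 2) x) :
    normalPart φ x (s.connection covM V x u) =
      s.h x u (tangentialPart φ x (V x)) + s.D (fun y => normalPart φ y (V y)) x u := by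
  rw [connection_eq, normalPart_dmap_add hφ _ (connection_normal_mem hs hφ V u)]

variable {J : Π y : N, TangentSpace (𝓡 4) y →L[ℝ] TangentSpace (𝓡 4) y}

lemma diffAlongAt_zero (hφ : ContMDiff (𝓡 2) (𝓡 4) ∞ φ) : DiffAlongAt φ 0 x := by
  have h := DiffAlongAt.smul (f := fun _ => (0 : ℝ)) mdifferentiableAt_const
    (diffAlongAt_dmap (x := x) hφ
    (smoothAt_extend (I := 𝓡 2) (x := x) (0 : TangentSpace (𝓡 2) x)).diffAt)
  exact h.congr (Filter.Eventually.of_forall fun y => by simp)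

lemma D_zero (hs : s.IsAdmissible covM J) (hφ : ContMDiff (𝓡 2) (𝓡 4) ∞ φ)
    (u : TangentSpace (𝓡 2) x) : s.D (fun _ => 0) x u = 0 := by
  have h := hs.D_leibniz (fun _ => (0 : ℝ)) 0 (fun y => Submodule.zero_mem _) x
    mdifferentiableAt_const (diffAlongAt_zero hφ) u
  simpa [mvfderiv_const] using h

/-- The operator `D` is local: multiply the fields by the indicator function of a neighbourhood,
which is differentiable at the point. -/
lemma D_congr (hs : s.IsAdmissible covM J) {ξ η : FieldAlong φ} (hξ : IsNormalField φ ξ)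
    (hη : IsNormalField φ η) (hξd : DiffAlongAt φ ξ x) (h : ∀ᶠ y in 𝓝 x, η y = ξ y)
    (u : TangentSpace (𝓡 2) x) : s.D η x u = s.D ξ x u := by
  classical
  have hηd : DiffAlongAt φ η x := hξd.congr h
  let f : M → ℝ := fun y => if η y = ξ y then 1 else 0
  have hf : f =ᶠ[𝓝 x] fun _ => (1 : ℝ) := by
    filter_upwards [h] with y hy
    simp [f, hy]
  have hfx : f x = 1 := hf.self_of_nhds
  have hfd : MDifferentiableAt (𝓡 2) 𝓘(ℝ, ℝ) f x :=
    mdifferentiableAt_const.congr_of_eventuallyEq hf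
  have hdf : mvfderiv (𝓡 2) f x = 0 := by rw [mvfderiv_congr hf, mvfderiv_const]
  have h1 := hs.D_leibniz f ξ hξ x hfd hξd u
  have h2 := hs.D_leibniz f η hη x hfd hηd u
  have heq : (fun y => f y • η y) = fun y => f y • ξ y := by
    funext y
    by_cases hy : η y = ξ y
    · rw [hy]
    · simp [f, hy]
  rw [heq, h1, hfx, hdf] at h2
  simpa using h2.symm

lemma connection_dmap (hs : s.IsAdmissible covM J) (hφ : IsIsometricImmersion φ)
    (Z : Π x : M, TangentSpace (𝓡 2) x) (u : TangentSpace (𝓡 2) x) :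
    s.connection covM (fun y => dmap φ y (Z y)) x u = dmap φ x (covM Z x u) + s.h x u (Z x) := by
  simp only [connection, tangentialPart_dmap hφ, normalPart_dmap hφ, D_zero hs hφ.smooth]
  simp

lemma connection_normal {ξ : FieldAlong φ} (hξ : IsNormalField φ ξ) (u : TangentSpace (𝓡 2) x) :
    s.connection covM ξ x u = dmap φ x (-s.A x (ξ x) u) + s.D ξ x u := by
  have h0 : covM (fun y => tangentialPart φ y (ξ y)) x = 0 := by
    simp only [tangentialPart_eq_zero_iff.2 (hξ _)]
    exact congrFun covM.zero x
  simp only [connection, normalPart_of_mem (hξ _), tangentialPart_eq_zero_iff.2 (hξ x), h0]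
  simp

variable [IsContMDiffRiemannianBundle (𝓡 2) ∞ (EuclideanSpace ℝ (Fin 2))
      (fun x : M => TangentSpace (𝓡 2) x)]
  [IsContMDiffRiemannianBundle (𝓡 4) ∞ (EuclideanSpace ℝ (Fin 4))
      (fun y : N => TangentSpace (𝓡 4) y)]

lemma connection_congr (hs : s.IsAdmissible covM J) (hφ : IsIsometricImmersion φ)
    {V W : FieldAlong φ} (hV : DiffAlongAt φ V x) (h : ∀ᶠ y in 𝓝 x, W y = V y)
    (u : TangentSpace (𝓡 2) x) : s.connection covM W x u = s.connection covM V x u := by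
  have h1 : covM (fun y => tangentialPart φ y (W y)) x =
      covM (fun y => tangentialPart φ y (V y)) x :=
    cov_congr (diffAt_tangentialPart hφ.smooth hV) (h.mono fun y hy => by rw [hy])
  have h2 : s.D (fun y => normalPart φ y (W y)) x u = s.D (fun y => normalPart φ y (V y)) x u :=
    D_congr hs (fun _ => normalPart_mem hφ _) (fun _ => normalPart_mem hφ _)
      (diffAlongAt_normalPart hφ.smooth hV) (h.mono fun y hy => by rw [hy]) u
  rw [connection, connection, h1, h2, h.self_of_nhds]

/-- The shape operators are smooth because `⟨A_ξ X, Y⟩ = ⟨h(X,Y), ξ⟩` is. -/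
lemma smoothAt_shape (hs : s.IsAdmissible covM J) {X : Π x : M, TangentSpace (𝓡 2) x}
    {ξ : FieldAlong φ} (hX : SmoothAt (𝓡 2) X x) (hξ : IsNormalField φ ξ)
    (hξs : SmoothAlongAt φ ξ x) : SmoothAt (𝓡 2) (fun y => s.A y (ξ y) (X y)) x :=
  smoothAt_of_inner fun Y hY => by
    have h := (hs.h_smooth X Y x hX hY).inner hξs
    simpa only [hs.A_dual _ _ _ _ (hξ _)] using h

lemma smoothAlongAt_connection (hs : s.IsAdmissible covM J) (hφ : IsIsometricImmersion φ)
    (hcovM : IsLeviCivita covM) {X : Π x : M, TangentSpace (𝓡 2) x} {V : FieldAlong φ}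
    (hX : SmoothAt (𝓡 2) X x) (hV : SmoothAlongAt φ V x) :
    SmoothAlongAt φ (fun y => s.connection covM V y (X y)) x := by
  have hT := smoothAt_tangentialPart hφ.smooth hV
  have hn := smoothAlongAt_normalPart hφ.smooth hV
  have hnn : IsNormalField φ (fun y => normalPart φ y (V y)) := fun _ => normalPart_mem hφ _
  exact (((smoothAlongAt_dmap hφ.smooth (hcovM.smooth X _ x hX hT)).add
    (hs.h_smooth X _ x hX hT)).sub
    (smoothAlongAt_dmap hφ.smooth (smoothAt_shape hs hX hnn hn))).add
    (hs.D_smooth X _ hnn x hX hn)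

/-- The connection assembled from admissible data is metric, as `A` is dual to `h`. -/
lemma connection_metric (hs : s.IsAdmissible covM J) (hφ : IsIsometricImmersion φ)
    (hcovM : IsLeviCivita covM) (V W : FieldAlong φ) (x : M) (hV : DiffAlongAt φ V x)
    (hW : DiffAlongAt φ W x) (u : TangentSpace (𝓡 2) x) :
    mvfderiv (𝓡 2) (fun y => (inner ℝ (V y) (W y) : ℝ)) x u =
      inner ℝ (s.connection covM V x u) (W x) + inner ℝ (V x) (s.connection covM W x u) := by
  have hm1 : IsContMDiffRiemannianBundle (𝓡 2) 1 (EuclideanSpace ℝ (Fin 2))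
      (fun x : M => TangentSpace (𝓡 2) x) :=
    IsContMDiffRiemannianBundle.of_le (n := ∞) (by norm_cast)
  have hVt := diffAt_tangentialPart hφ.smooth hV
  have hWt := diffAt_tangentialPart hφ.smooth hW
  have hVn := diffAlongAt_normalPart hφ.smooth hV
  have hWn := diffAlongAt_normalPart hφ.smooth hW
  have hnV : IsNormalField φ (fun y => normalPart φ y (V y)) := fun _ => normalPart_mem hφ _
  have hnW : IsNormalField φ (fun y => normalPart φ y (W y)) := fun _ => normalPart_mem hφ _
  have ht : MDifferentiableAt (𝓡 2) 𝓘(ℝ, ℝ) (fun y =>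
      (inner ℝ (tangentialPart φ y (V y)) (tangentialPart φ y (W y)) : ℝ)) x :=
    MDifferentiableAt.inner_bundle (IB := 𝓡 2) (E := fun y : M => TangentSpace (𝓡 2) y)
      (b := fun y : M => y) hVt hWt
  simp only [inner_eq_inner_parts hφ (V _) (W _)]
  rw [mvfderiv_fun_add ht (hVn.inner hWn), add_apply, hcovM.metric _ _ x hVt hWt,
    hs.D_metric _ _ hnV hnW x hVn hWn, inner_eq_inner_parts hφ _ (W x),
    inner_eq_inner_parts hφ (V x) _]
  simp only [tangentialPart_connection hs.toNormalValued hφ,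
    normalPart_connection hs.toNormalValued hφ, inner_sub_left, inner_sub_right, inner_add_left,
    inner_add_right]
  have h1 := hs.A_dual x u (tangentialPart φ x (W x)) _ (hnV x)
  have h2 := hs.A_dual x u (tangentialPart φ x (V x)) _ (hnW x)
  rw [real_inner_comm] at h1
  rw [real_inner_comm _ (s.A x (normalPart φ x (W x)) u)] at h2
  linarith

variable {X Y Z : Π x : M, TangentSpace (𝓡 2) x} {V W ξ : FieldAlong φ}

lemma inner_connectionCurvature_skew (hs : s.IsAdmissible covM J) (hφ : IsIsometricImmersion φ)
    (hcovM : IsLeviCivita covM) (hX : SmoothAt (𝓡 2) X x) (hY : SmoothAt (𝓡 2) Y x)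
    (hV : SmoothAlongAt φ V x) (hW : SmoothAlongAt φ W x) :
    inner ℝ (sectionCurvature (s.connection covM) X Y V x) (W x) +
      inner ℝ (V x) (sectionCurvature (s.connection covM) X Y W x) = (0 : ℝ) :=
  inner_sectionCurvature_skew (nabla := s.connection covM) (D := DiffAlongAt φ)
    (fun _ _ _ hZ hW => hZ.inner hW) (connection_metric hs hφ hcovM) hX.diffAt hY.diffAt
    hV.eventually_diffAlongAt hW.eventually_diffAlongAt
    (smoothAlongAt_connection hs hφ hcovM hX hV).diffAlongAt
    (smoothAlongAt_connection hs hφ hcovM hY hV).diffAlongAt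
    (smoothAlongAt_connection hs hφ hcovM hX hW).diffAlongAt
    (smoothAlongAt_connection hs hφ hcovM hY hW).diffAlongAt
    ((hV.inner hW).of_le (by norm_cast))

lemma exists_smooth_fieldAlong (hφ : IsIsometricImmersion φ) (w : TangentSpace (𝓡 4) (φ x)) :
    ∃ V : FieldAlong φ, SmoothAlongAt φ V x ∧ V x = w :=
  ⟨_, SmoothAt.smoothAlongAt_comp hφ.smooth.contMDiffAt (smoothAt_extend w),
    FiberBundle.extend_apply_self _ _⟩

/-- The curvature of the assembled connection depends on the differentiated field only through its
value at the point, because it is skew-symmetric. -/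
lemma connectionCurvature_congr (hs : s.IsAdmissible covM J) (hφ : IsIsometricImmersion φ)
    (hcovM : IsLeviCivita covM) (hX : SmoothAt (𝓡 2) X x) (hY : SmoothAt (𝓡 2) Y x)
    (hV : SmoothAlongAt φ V x) (hW : SmoothAlongAt φ W x) (hVW : V x = W x) :
    sectionCurvature (s.connection covM) X Y V x =
      sectionCurvature (s.connection covM) X Y W x := by
  refine ext_inner_right ℝ fun v => ?_
  obtain ⟨U, hU, rfl⟩ := exists_smooth_fieldAlong hφ v
  have h1 := inner_connectionCurvature_skew hs hφ hcovM hX hY hV hU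
  have h2 := inner_connectionCurvature_skew hs hφ hcovM hX hY hW hU
  rw [hVW] at h1
  linarith

/-- As `J` is parallel for the assembled connection, it commutes with the curvature. -/
lemma connectionCurvature_end_apply (hs : s.IsAdmissible covM J) (hφ : IsIsometricImmersion φ)
    (hcovM : IsLeviCivita covM) (hJ : SmoothEnd J) (hX : SmoothAt (𝓡 2) X x)
    (hY : SmoothAt (𝓡 2) Y x) (hV : SmoothAlongAt φ V x) :
    sectionCurvature (s.connection covM) X Y (fun y => J (φ y) (V y)) x =
      J (φ x) (sectionCurvature (s.connection covM) X Y V x) := by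
  have key : ∀ S T : Π x : M, TangentSpace (𝓡 2) x, SmoothAt (𝓡 2) S x →
      s.connection covM (fun y => s.connection covM (fun y => J (φ y) (V y)) y (S y)) x (T x) =
      J (φ x) (s.connection covM (fun y => s.connection covM V y (S y)) x (T x)) := by
    intro S T hS
    have hd := (smoothAlongAt_connection hs hφ hcovM hS hV).diffAlongAt
    rw [connection_congr hs hφ (hd.end_apply hJ hφ.smooth), hs.J_parallel _ x hd]
    filter_upwards [hV.eventually_diffAlongAt] with y hy
    exact hs.J_parallel V y hy _
  rw [sectionCurvature, sectionCurvature, key Y X hY, key X Y hX, hs.J_parallel _ x hV.diffAlongAt,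
    map_sub, map_sub]

/-- The right-hand side of the equation of Codazzi. -/
lemma normalPart_connectionCurvature_dmap (hs : s.IsAdmissible covM J)
    (hφ : IsIsometricImmersion φ) (hcovM : IsLeviCivita covM) (hX : SmoothAt (𝓡 2) X x)
    (hY : SmoothAt (𝓡 2) Y x) :
    normalPart φ x (sectionCurvature (s.connection covM) X Y (fun y => dmap φ y (Z y)) x) =
      s.derivH covM X Y Z x - s.derivH covM Y X Z x := by
  have htor := covM.torsion_eq_zero_iff.1 hcovM.torsion_free hX.diffAt hY.diffAt
  simp only [sectionCurvature, normalPart_sub, connection_dmap hs hφ,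
    normalPart_connection hs.toNormalValued hφ,
    tangentialPart_dmap_add hφ _ (hs.h_normal _ _ _), normalPart_dmap_add hφ _ (hs.h_normal _ _ _)]
  rw [← htor]
  simp only [derivH, map_sub, sub_apply]
  rw [hs.h_symm x (covM X x (Y x)) (Z x), hs.h_symm x (covM Y x (X x)) (Z x)]
  abel

/-- The right-hand side of the equation of Gauss. -/
lemma tangentialPart_connectionCurvature_dmap (hs : s.IsAdmissible covM J)
    (hφ : IsIsometricImmersion φ) :
    tangentialPart φ x (sectionCurvature (s.connection covM) X Y (fun y => dmap φ y (Z y)) x) =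
      curvature covM X Y Z x + s.A x (s.h x (X x) (Z x)) (Y x)
        - s.A x (s.h x (Y x) (Z x)) (X x) := by
  simp only [sectionCurvature, map_sub, connection_dmap hs hφ,
    tangentialPart_connection hs.toNormalValued hφ,
    tangentialPart_dmap_add hφ _ (hs.h_normal _ _ _), normalPart_dmap_add hφ _ (hs.h_normal _ _ _),
    curvature]
  abel

/-- The right-hand side of the equation of Ricci. -/
lemma normalPart_connectionCurvature_normal (hs : s.IsAdmissible covM J)
    (hφ : IsIsometricImmersion φ) (hξ : IsNormalField φ ξ) :
    normalPart φ x (sectionCurvature (s.connection covM) X Y ξ x) =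
      s.h x (s.A x (ξ x) (X x)) (Y x) - s.h x (X x) (s.A x (ξ x) (Y x))
        + s.normalCurvature X Y ξ x := by
  simp only [sectionCurvature, normalPart_sub, connection_normal hξ,
    normalPart_connection hs.toNormalValued hφ,
    tangentialPart_dmap_add hφ _ (hs.D_normal ξ hξ _ _),
    normalPart_dmap_add hφ _ (hs.D_normal ξ hξ _ _),
    normalCurvature]
  rw [hs.h_symm x (s.A x (ξ x) (X x)) (Y x)]
  simp only [map_neg]
  abel

variable {covN : CovariantDerivative (𝓡 4) (EuclideanSpace ℝ (Fin 4))
      (TangentSpace (𝓡 4) : N → Type _)}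

/-- The operator `R̃(X,Y) - K(X,Y)`, where `K` is the curvature of the assembled connection,
vanishes by `eq_zero_of_skew_of_commute`; its tangential part on tangent vectors is the equation of
Gauss. -/
theorem IsAdmissible.gaussEquation (hs : s.IsAdmissible covM J) (hφ : IsIsometricImmersion φ)
    (hcovM : IsLeviCivita covM) (hN : IsKaehler covN J) (hreal : IsPurelyReal J φ)
    (hC : s.CodazziEquation covN covM) (hR : s.RicciEquation covN) :
    s.GaussEquation covN covM := by
  intro X Y Z x hX hY hZ
  choose ext hext_smooth hext using fun w => exists_smooth_fieldAlong hφ (x := x) w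
  let R : TangentSpace (𝓡 4) (φ x) → TangentSpace (𝓡 4) (φ x) :=
    curvatureTensor covN (φ x) (dmap φ x (X x)) (dmap φ x (Y x))
  let K : TangentSpace (𝓡 4) (φ x) → TangentSpace (𝓡 4) (φ x) := fun w =>
    sectionCurvature (s.connection covM) X Y (ext w) x
  have hK : ∀ V : FieldAlong φ, SmoothAlongAt φ V x →
      K (V x) = sectionCurvature (s.connection covM) X Y V x := fun V hV =>
    connectionCurvature_congr hs hφ hcovM hX hY (hext_smooth _) hV (hext _)
  have hmem : ∀ w, normalPart φ x w = 0 → w ∈ Set.range (dmap φ x) := fun w hw =>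
    ⟨tangentialPart φ x w, by
      have h := dmap_tangentialPart_add_normalPart w
      rwa [hw, add_zero] at h⟩
  have hzero : ∀ w, R w - K w = 0 := by
    refine eq_zero_of_skew_of_commute (J := J (φ x)) (P := Set.range (dmap φ x)) (hN.sq _)
      (map_zero _) ?_ ?_ ?_ ?_ ?_ ?_ ?_
    · rintro _ ⟨u, rfl⟩ ⟨v, hv⟩
      have h : J (φ x) (dmap φ x u) ∈
          (dmap φ x).range.map (J (φ x) : TangentSpace (𝓡 4) (φ x) →ₗ[ℝ] _) ⊓ (dmap φ x).range :=
        ⟨⟨_, ⟨u, rfl⟩, rfl⟩, ⟨v, hv⟩⟩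
      rwa [hreal x, Submodule.mem_bot] at h
    · rintro _ _ ⟨u, rfl⟩ ⟨v, rfl⟩
      exact ⟨u + v, map_add _ _ _⟩
    · intro v w
      have h1 := inner_curvatureTensor_skew hN.leviCivita (dmap φ x (X x)) (dmap φ x (Y x)) v w
      have h2 := inner_connectionCurvature_skew hs hφ hcovM hX hY (hext_smooth v) (hext_smooth w)
      rw [hext, hext] at h2
      rw [inner_sub_left, inner_sub_right]
      simp only [R, K]
      linarith
    · intro v
      have h1 := curvatureTensor_end_apply hN (dmap φ x (X x)) (dmap φ x (Y x)) v
      have h2 := hK _ ((hext_smooth v).end_apply hN.smooth hφ.smooth)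
      rw [hext, connectionCurvature_end_apply hs hφ hcovM hN.smooth hX hY (hext_smooth v)] at h2
      rw [map_sub, h2]
      simp only [R, K, h1]
    · rintro _ ⟨u, rfl⟩
      have hu := smoothAt_extend (I := 𝓡 2) u
      have h1 := hC X Y _ x hX hY hu
      have h2 := hK _ (smoothAlongAt_dmap hφ.smooth hu)
      rw [FiberBundle.extend_apply_self] at h1 h2
      refine hmem _ ?_
      rw [normalPart_sub, h2, normalPart_connectionCurvature_dmap hs hφ hcovM hX hY]
      exact sub_eq_zero.2 h1
    · intro w hw
      have hwn : w ∈ normalSpace φ x := mem_normalSpace_iff.2 fun u => hw _ ⟨u, rfl⟩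
      have hn : IsNormalField φ (fun y => normalPart φ y (ext w y)) := fun _ => normalPart_mem hφ _
      have hns := smoothAlongAt_normalPart hφ.smooth (hext_smooth w)
      have h1 := hR X Y _ x hn hX hY hns
      have h2 := hK _ hns
      have h3 : normalPart φ x (ext w x) = w := by rw [hext, normalPart_of_mem hwn]
      refine hmem _ ?_
      rw [normalPart_sub, ← h3, h2, normalPart_connectionCurvature_normal hs hφ hn]
      exact sub_eq_zero.2 h1
    · intro v
      exact ⟨_, ⟨_, rfl⟩, _, fun _ ⟨u, hu⟩ => hu ▸ mem_normalSpace_iff.1 (normalPart_mem hφ v) u,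
        dmap_tangentialPart_add_normalPart v⟩
  have h1 := sub_eq_zero.1 (hzero (dmap φ x (Z x)))
  rw [hK _ (smoothAlongAt_dmap hφ.smooth hZ)] at h1
  rw [← tangentialPart_connectionCurvature_dmap hs hφ, ← h1]

end FundamentalForms

end Surfaces

/-! ### Reduction to sections with constant components -/

section ExtensionInduction

variable {B F : Type*} {V : B → Type*} [TopologicalSpace B] [TopologicalSpace (TotalSpace F V)]
  [∀ x, TopologicalSpace (V x)] [NormedAddCommGroup F] [NormedSpace ℝ F] [FiberBundle F V]
  [∀ x, AddCommGroup (V x)] [∀ x, Module ℝ (V x)] [VectorBundle ℝ F V] {b₀ : B}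

lemma extend_eq_symmL {y : B} (hy : y ∈ (trivializationAt F V b₀).baseSet) (v : V b₀) :
    FiberBundle.extend F v y = (trivializationAt F V b₀).symmL ℝ y
      ((trivializationAt F V b₀).continuousLinearMapAt ℝ b₀ v) := by
  rw [FiberBundle.extend, Bundle.Trivialization.symmL_apply _ hy,
    Bundle.Trivialization.continuousLinearMapAt_apply,
    Bundle.Trivialization.coe_linearMapAt_of_mem _ (mem_baseSet_trivializationAt F V b₀)]

lemma extend_add {y : B} (hy : y ∈ (trivializationAt F V b₀).baseSet) (v w : V b₀) :
    FiberBundle.extend F (v + w) y = FiberBundle.extend F v y + FiberBundle.extend F w y := by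
  simp only [extend_eq_symmL hy, map_add]

lemma extend_smul {y : B} (hy : y ∈ (trivializationAt F V b₀).baseSet) (c : ℝ) (v : V b₀) :
    FiberBundle.extend F (c • v) y = c • FiberBundle.extend F v y := by
  simp only [extend_eq_symmL hy, map_smul]

lemma trivializationAt_extend {y : B} (hy : y ∈ (trivializationAt F V b₀).baseSet)
    (v : V b₀) : (trivializationAt F V b₀ ⟨y, FiberBundle.extend F v y⟩).2 =
      (trivializationAt F V b₀ ⟨b₀, v⟩).2 := by
  rw [FiberBundle.extend, Bundle.Trivialization.apply_mk_symm _ hy]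

variable {HB : Type*} [TopologicalSpace HB] [ChartedSpace HB B]
  {EB : Type*} [NormedAddCommGroup EB] [NormedSpace ℝ EB] {IB : ModelWithCorners ℝ EB HB}
  {E : Type*} [NormedAddCommGroup E] [NormedSpace ℝ E]
  {H : Type*} [TopologicalSpace H] {I : ModelWithCorners ℝ E H}
  {M : Type*} [TopologicalSpace M] [ChartedSpace H M] [FiniteDimensional ℝ F]
  {b : M → B} {v : Π x : M, V (b x)} {x : M} {n : WithTop ℕ∞}

lemma along_sum_mem {P : (Π x : M, V (b x)) → Prop}
    (hzero : P fun _ => 0) (hadd : ∀ v w, P v → P w → P fun y => v y + w y)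
    {ι : Type*} (s : Finset ι) (v : ι → Π x : M, V (b x)) (h : ∀ i ∈ s, P (v i)) :
    P fun y => ∑ i ∈ s, v i y := by
  classical
  induction s using Finset.induction_on with
  | empty => simpa using hzero
  | insert i s hi ih =>
    simp only [Finset.sum_insert hi]
    exact hadd _ _ (h i (Finset.mem_insert_self i s))
      (ih fun j hj => h j (Finset.mem_insert_of_mem hj))

/-- A section along `b` is, near `x`, a combination of the restrictions of sections of the bundle
with constant components. A property of sections along `b` therefore follows from that of these
restrictions, if it is local and stable under sums and multiplication by the functions of a class
`C` which contains the components of the given section. -/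
lemma along_induction (hb : ContinuousAt b x) {C : (M → ℝ) → Prop}
    {P : (Π x : M, V (b x)) → Prop}
    (hcongr : ∀ v w, P v → (∀ᶠ y in 𝓝 x, w y = v y) → P w)
    (hadd : ∀ v w, P v → P w → P fun y => v y + w y)
    (hsmul : ∀ (f : M → ℝ) v, C f → P v → P fun y => f y • v y)
    (hextend : ∀ w : V (b x), P fun y => FiberBundle.extend F w (b y))
    (hv : ∀ L : F →L[ℝ] ℝ, C fun y => L (trivializationAt F V (b x) ⟨b y, v y⟩).2) : P v := by
  let t := trivializationAt F V (b x)
  let e := Module.finBasis ℝ F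
  have hx : b x ∈ t.baseSet := mem_baseSet_trivializationAt F V (b x)
  have hzero : P fun _ => 0 := by
    refine hcongr _ _ (hextend 0) ?_
    filter_upwards [hb (t.open_baseSet.mem_nhds hx)] with y hy
    rw [extend_eq_symmL hy, map_zero, map_zero]
  refine hcongr _ _ (along_sum_mem hzero hadd Finset.univ (fun i y =>
    (e.coord i).toContinuousLinearMap (t ⟨b y, v y⟩).2 •
      FiberBundle.extend F (t.symm (b x) (e i)) (b y))
    fun i _ => hsmul _ _ (hv _) (hextend _)) ?_
  filter_upwards [hb (t.open_baseSet.mem_nhds hx)] with y hy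
  have hy : b y ∈ t.baseSet := hy
  have h1 : v y = t.symmL ℝ (b y) (t ⟨b y, v y⟩).2 := by
    rw [t.symmL_apply hy, t.symm_apply_apply_mk hy]
  have h2 : ∀ i, FiberBundle.extend F (t.symm (b x) (e i)) (b y) = t.symmL ℝ (b y) (e i) := by
    intro i
    rw [t.symmL_apply hy, FiberBundle.extend, t.apply_mk_symm hx]
  simp only [h2, ← map_smul, ← map_sum]
  conv_lhs => rw [h1, ← e.sum_repr (t ⟨b y, v y⟩).2]
  rfl

lemma contMDiffAt_along_induction
    (hv : ContMDiffAt I (IB.prod 𝓘(ℝ, F)) n (fun y => TotalSpace.mk' F (b y) (v y)) x)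
    {P : (Π x : M, V (b x)) → Prop}
    (hcongr : ∀ v w, P v → (∀ᶠ y in 𝓝 x, w y = v y) → P w)
    (hadd : ∀ v w, P v → P w → P fun y => v y + w y)
    (hsmul : ∀ (f : M → ℝ) v, ContMDiffAt I 𝓘(ℝ, ℝ) n f x → P v → P fun y => f y • v y)
    (hextend : ∀ w : V (b x), P fun y => FiberBundle.extend F w (b y)) : P v := by
  rw [contMDiffAt_totalSpace] at hv
  exact along_induction hv.1.continuousAt hcongr hadd hsmul hextend fun L =>
    L.contMDiff.contMDiffAt.comp x hv.2

lemma mdifferentiableAt_along_induction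
    (hv : MDifferentiableAt I (IB.prod 𝓘(ℝ, F)) (fun y => TotalSpace.mk' F (b y) (v y)) x)
    {P : (Π x : M, V (b x)) → Prop}
    (hcongr : ∀ v w, P v → (∀ᶠ y in 𝓝 x, w y = v y) → P w)
    (hadd : ∀ v w, P v → P w → P fun y => v y + w y)
    (hsmul : ∀ (f : M → ℝ) v, MDifferentiableAt I 𝓘(ℝ, ℝ) f x → P v → P fun y => f y • v y)
    (hextend : ∀ w : V (b x), P fun y => FiberBundle.extend F w (b y)) : P v := by
  rw [mdifferentiableAt_totalSpace] at hv
  exact along_induction hv.1.continuousAt hcongr hadd hsmul hextend fun L =>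
    L.mdifferentiableAt.comp x hv.2

end ExtensionInduction

/-! ### The pulled back connection -/

section CovAlong

variable {M : Type*} [TopologicalSpace M] [ChartedSpace (EuclideanSpace ℝ (Fin 2)) M]
  [IsManifold (𝓡 2) ∞ M]
  {N : Type*} [TopologicalSpace N] [ChartedSpace (EuclideanSpace ℝ (Fin 4)) N]
  [IsManifold (𝓡 4) ∞ N] {φ : M → N} {V W : FieldAlong φ} {f : M → ℝ} {x : M}
  {cov : CovariantDerivative (𝓡 4) (EuclideanSpace ℝ (Fin 4)) (TangentSpace (𝓡 4) : N → Type _)}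

/-- The components of a field along `φ` in the coordinate frame of the preferred chart
at `φ x`. -/
def components (φ : M → N) (V : FieldAlong φ) (x y : M) : EuclideanSpace ℝ (Fin 4) :=
  (trivializationAt (EuclideanSpace ℝ (Fin 4)) (TangentSpace (𝓡 4) : N → Type _) (φ x)
    ⟨φ y, V y⟩).2

lemma DiffAlongAt.components (hV : DiffAlongAt φ V x) :
    MDifferentiableAt (𝓡 2) 𝓘(ℝ, EuclideanSpace ℝ (Fin 4)) (components φ V x) x :=
  ((mdifferentiableAt_totalSpace _ _).1 hV).2

lemma DiffAlongAt.continuousAt (hV : DiffAlongAt φ V x) : ContinuousAt φ x :=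
  ((mdifferentiableAt_totalSpace _ _).1 hV).1.continuousAt

lemma eventually_mem_chart (hφ : ContinuousAt φ x) : ∀ᶠ y in 𝓝 x,
    φ y ∈ (trivializationAt (EuclideanSpace ℝ (Fin 4)) (TangentSpace (𝓡 4) : N → Type _)
      (φ x)).baseSet :=
  eventually_mem_baseSet_of_continuousAt (F := EuclideanSpace ℝ (Fin 4))
    (V := (TangentSpace (𝓡 4) : N → Type _)) hφ

lemma covAlong_eq (u : TangentSpace (𝓡 2) x) : covAlong cov φ V x u =
    (trivializationAt (EuclideanSpace ℝ (Fin 4)) (TangentSpace (𝓡 4) : N → Type _)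
      (φ x)).symmL ℝ (φ x) (mvfderiv (𝓡 2) (components φ V x) x u) +
    cov (FiberBundle.extend (EuclideanSpace ℝ (Fin 4)) (V x)) (φ x) (dmap φ x u) := by
  rw [Bundle.Trivialization.symmL_apply _ (mem_baseSet_trivializationAt _ _ _)]
  rfl

lemma covAlong_congr (h : ∀ᶠ y in 𝓝 x, W y = V y) (u : TangentSpace (𝓡 2) x) :
    covAlong cov φ W x u = covAlong cov φ V x u := by
  have h1 : components φ W x =ᶠ[𝓝 x] components φ V x := by
    filter_upwards [h] with y hy
    rw [components, components, hy]
  rw [covAlong_eq, covAlong_eq, mvfderiv_congr h1, h.self_of_nhds]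

lemma covAlong_add (hV : DiffAlongAt φ V x) (hW : DiffAlongAt φ W x)
    (u : TangentSpace (𝓡 2) x) :
    covAlong cov φ (fun y => V y + W y) x u = covAlong cov φ V x u + covAlong cov φ W x u := by
  have h1 : components φ (fun y => V y + W y) x =ᶠ[𝓝 x]
      fun y => components φ V x y + components φ W x y := by
    filter_upwards [eventually_mem_chart hV.continuousAt] with y hy
    exact (Bundle.Trivialization.linear ℝ _ hy).map_add _ _
  have hv := (smoothAt_extend (I := 𝓡 4) (V x)).diffAt
  have hw := (smoothAt_extend (I := 𝓡 4) (W x)).diffAt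
  have h2 : cov (FiberBundle.extend (EuclideanSpace ℝ (Fin 4)) (V x + W x)) (φ x) =
      cov (FiberBundle.extend (EuclideanSpace ℝ (Fin 4)) (V x)) (φ x) +
      cov (FiberBundle.extend (EuclideanSpace ℝ (Fin 4)) (W x)) (φ x) := by
    rw [← cov_add hv hw]
    refine cov_congr (hv.add hw) ?_
    filter_upwards [(Bundle.Trivialization.open_baseSet _).mem_nhds
      (mem_baseSet_trivializationAt (EuclideanSpace ℝ (Fin 4)) (TangentSpace (𝓡 4)) (φ x))]
      with y hy
    exact extend_add hy _ _
  rw [covAlong_eq, covAlong_eq, covAlong_eq, mvfderiv_congr h1,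
    mvfderiv_fun_add hV.components hW.components, h2, add_apply, add_apply, map_add]
  abel

lemma covAlong_smul (hf : MDifferentiableAt (𝓡 2) 𝓘(ℝ, ℝ) f x) (hV : DiffAlongAt φ V x)
    (u : TangentSpace (𝓡 2) x) :
    covAlong cov φ (fun y => f y • V y) x u =
      f x • covAlong cov φ V x u + mvfderiv (𝓡 2) f x u • V x := by
  have h1 : components φ (fun y => f y • V y) x =ᶠ[𝓝 x]
      fun y => f y • components φ V x y := by
    filter_upwards [eventually_mem_chart hV.continuousAt] with y hy
    exact (Bundle.Trivialization.linear ℝ _ hy).map_smul _ _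
  have hv := (smoothAt_extend (I := 𝓡 4) (V x)).diffAt
  have hc : MDifferentiableAt (𝓡 4) 𝓘(ℝ, ℝ) (fun _ : N => f x) (φ x) := mdifferentiableAt_const
  have h2 : cov (FiberBundle.extend (EuclideanSpace ℝ (Fin 4)) (f x • V x)) (φ x) (dmap φ x u) =
      f x • cov (FiberBundle.extend (EuclideanSpace ℝ (Fin 4)) (V x)) (φ x) (dmap φ x u) := by
    have h3 := cov_smul (cov := cov) hc hv (dmap φ x u)
    rw [mvfderiv_const, zero_apply, zero_smul, add_zero] at h3
    rw [← h3]
    refine congrArg (fun T => T (dmap φ x u)) (cov_congr (hv.smul hc) ?_)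
    filter_upwards [(Bundle.Trivialization.open_baseSet _).mem_nhds
      (mem_baseSet_trivializationAt (EuclideanSpace ℝ (Fin 4)) (TangentSpace (𝓡 4)) (φ x))]
      with y hy
    exact extend_smul hy _ _
  have h4 : (trivializationAt (EuclideanSpace ℝ (Fin 4)) (TangentSpace (𝓡 4) : N → Type _)
      (φ x)).symmL ℝ (φ x) (components φ V x x) = V x := by
    rw [Bundle.Trivialization.symmL_apply _ (mem_baseSet_trivializationAt _ _ _)]
    exact Bundle.Trivialization.symm_apply_apply_mk _ (mem_baseSet_trivializationAt _ _ _) _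
  rw [covAlong_eq, covAlong_eq, mvfderiv_congr h1, mvfderiv_fun_smul hf hV.components, h2,
    add_apply, smul_apply, ContinuousLinearMap.smulRight_apply, map_add, map_smul, map_smul, h4,
    smul_add]
  abel

lemma covAlong_extend (hφ : ContinuousAt φ x) (w : TangentSpace (𝓡 4) (φ x))
    (u : TangentSpace (𝓡 2) x) :
    covAlong cov φ (fun y => FiberBundle.extend (EuclideanSpace ℝ (Fin 4)) w (φ y)) x u =
      cov (FiberBundle.extend (EuclideanSpace ℝ (Fin 4)) w) (φ x) (dmap φ x u) := by
  have h1 : components φ (fun y => FiberBundle.extend (EuclideanSpace ℝ (Fin 4)) w (φ y)) x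
      =ᶠ[𝓝 x] fun _ => (trivializationAt (EuclideanSpace ℝ (Fin 4))
        (TangentSpace (𝓡 4) : N → Type _) (φ x) ⟨φ x, w⟩).2 := by
    filter_upwards [eventually_mem_chart hφ] with y hy
    exact trivializationAt_extend hy w
  rw [covAlong_eq, mvfderiv_congr h1, mvfderiv_const, zero_apply, map_zero, zero_add,
    FiberBundle.extend_apply_self]

lemma DiffAlongAt.induction (hV : DiffAlongAt φ V x) {P : FieldAlong φ → Prop}
    (hcongr : ∀ V W, P V → (∀ᶠ y in 𝓝 x, W y = V y) → P W)
    (hadd : ∀ V W, P V → P W → P fun y => V y + W y)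
    (hsmul : ∀ (f : M → ℝ) V, MDifferentiableAt (𝓡 2) 𝓘(ℝ, ℝ) f x → P V → P fun y => f y • V y)
    (hextend : ∀ w : TangentSpace (𝓡 4) (φ x),
      P fun y => FiberBundle.extend (EuclideanSpace ℝ (Fin 4)) w (φ y)) : P V :=
  mdifferentiableAt_along_induction hV hcongr hadd hsmul hextend

lemma SmoothAlongAt.induction (hV : SmoothAlongAt φ V x) {P : FieldAlong φ → Prop}
    (hcongr : ∀ V W, P V → (∀ᶠ y in 𝓝 x, W y = V y) → P W)
    (hadd : ∀ V W, P V → P W → P fun y => V y + W y)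
    (hsmul : ∀ (f : M → ℝ) V, ContMDiffAt (𝓡 2) 𝓘(ℝ, ℝ) ∞ f x → P V → P fun y => f y • V y)
    (hextend : ∀ w : TangentSpace (𝓡 4) (φ x),
      P fun y => FiberBundle.extend (EuclideanSpace ℝ (Fin 4)) w (φ y)) : P V :=
  contMDiffAt_along_induction hV hcongr hadd hsmul hextend

lemma diffAlongAt_extend (hφ : MDifferentiableAt (𝓡 2) (𝓡 4) φ x)
    (w : TangentSpace (𝓡 4) (φ x)) :
    DiffAlongAt φ (fun y => FiberBundle.extend (EuclideanSpace ℝ (Fin 4)) w (φ y)) x :=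
  (smoothAt_extend w).diffAt.diffAlongAt_comp hφ

/-- The pulled back connection is the given one on the restrictions of vector fields of `N`. -/
lemma covAlong_comp (hφ : MDifferentiableAt (𝓡 2) (𝓡 4) φ x) {Z : Π y : N, TangentSpace (𝓡 4) y}
    (hZ : DiffAt (𝓡 4) Z (φ x)) (u : TangentSpace (𝓡 2) x) :
    covAlong cov φ (fun y => Z (φ y)) x u = cov Z (φ x) (dmap φ x u) := by
  refine (mdifferentiableAt_along_induction (b := fun y : N => y) hZ
    (P := fun Z => DiffAt (𝓡 4) Z (φ x) ∧
      covAlong cov φ (fun y => Z (φ y)) x u = cov Z (φ x) (dmap φ x u)) ?_ ?_ ?_ ?_).2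
  · rintro Z W ⟨hZ, h⟩ hW
    refine ⟨hZ.congr hW, ?_⟩
    rw [cov_congr hZ hW, ← h]
    exact covAlong_congr (hφ.continuousAt.eventually hW) u
  · rintro Z W ⟨hZ, h⟩ ⟨hW, h'⟩
    refine ⟨hZ.add hW, ?_⟩
    rw [covAlong_add (hZ.diffAlongAt_comp hφ) (hW.diffAlongAt_comp hφ), cov_add hZ hW, h, h',
      add_apply]
  · rintro f Z hf ⟨hZ, h⟩
    refine ⟨hZ.smul hf, ?_⟩
    have h1 := covAlong_smul (cov := cov) (f := f ∘ φ) (hf.comp x hφ) (hZ.diffAlongAt_comp hφ) u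
    rw [h, mvfderiv_comp_apply x hf hφ] at h1
    rw [cov_smul hf hZ]
    exact h1
  · intro w
    exact ⟨(smoothAt_extend w).diffAt, covAlong_extend hφ.continuousAt w u⟩

lemma contMDiffAt_mvfderiv_apply {X : Π x : M, TangentSpace (𝓡 2) x}
    (hf : ContMDiffAt (𝓡 2) 𝓘(ℝ, ℝ) ∞ f x) (hX : SmoothAt (𝓡 2) X x) :
    ContMDiffAt (𝓡 2) 𝓘(ℝ, ℝ) ∞ (fun y => mvfderiv (𝓡 2) f y (X y)) x := by
  have hf' := contDiffAt_comp_extChartAt_symm le_rfl hf (mem_extChartAt_source x)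
  have h : ContDiffAt ℝ ∞ (fun p => fderiv ℝ (f ∘ (extChartAt (𝓡 2) x).symm) p (chartField X x p))
      (extChartAt (𝓡 2) x x) :=
    (hf'.fderiv_right (m := ∞) (by simp)).clm_apply (contDiffAt_chartField hX)
  exact (h.contMDiffAt.comp x contMDiffAt_extChartAt).congr_of_eventuallyEq
    (mvfderiv_eventuallyEq_chart (hf.of_le (by norm_cast)) X)

variable {J : Π y : N, TangentSpace (𝓡 4) y →L[ℝ] TangentSpace (𝓡 4) y}

section Smooth
variable [RiemannianBundle (fun y : N => TangentSpace (𝓡 4) y)]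
  [IsContMDiffRiemannianBundle (𝓡 4) ∞ (EuclideanSpace ℝ (Fin 4))
      (fun y : N => TangentSpace (𝓡 4) y)]

/-- `J` is parallel for the pulled back connection. -/
lemma covAlong_end_apply
    (hφ : ContMDiff (𝓡 2) (𝓡 4) ∞ φ) (hN : IsKaehler cov J)
    (hV : DiffAlongAt φ V x) (u : TangentSpace (𝓡 2) x) :
    covAlong cov φ (fun y => J (φ y) (V y)) x u = J (φ x) (covAlong cov φ V x u) := by
  have hφx := hφ.contMDiffAt.mdifferentiableAt (x := x) (by simp)
  refine (hV.induction (P := fun V => DiffAlongAt φ V x ∧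
    covAlong cov φ (fun y => J (φ y) (V y)) x u = J (φ x) (covAlong cov φ V x u)) ?_ ?_ ?_ ?_).2
  · rintro V W ⟨hV, h⟩ hW
    refine ⟨hV.congr hW, ?_⟩
    rw [covAlong_congr hW, ← h]
    exact covAlong_congr (hW.mono fun y hy => by rw [hy]) u
  · rintro V W ⟨hV, h⟩ ⟨hW, h'⟩
    refine ⟨hV.add hW, ?_⟩
    simp only [map_add]
    rw [covAlong_add (hV.end_apply hN.smooth hφ) (hW.end_apply hN.smooth hφ), covAlong_add hV hW,
      h, h', map_add]
  · rintro f V hf ⟨hV, h⟩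
    refine ⟨hV.smul hf, ?_⟩
    simp only [map_smul]
    rw [covAlong_smul hf (hV.end_apply hN.smooth hφ), covAlong_smul hf hV, h, map_add, map_smul,
      map_smul]
  · intro w
    have hw := (smoothAt_extend (I := 𝓡 4) w).diffAt
    refine ⟨diffAlongAt_extend hφx w, ?_⟩
    rw [covAlong_extend hφx.continuousAt, ← hN.parallel _ _ hw]
    exact covAlong_comp hφx (hw.end_apply hN.smooth) u

/-- The pulled back connection is metric. -/
lemma covAlong_metric (hφ : ContMDiff (𝓡 2) (𝓡 4) ∞ φ) (hcov : IsLeviCivita cov)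
    (hV : DiffAlongAt φ V x) (hW : DiffAlongAt φ W x) (u : TangentSpace (𝓡 2) x) :
    mvfderiv (𝓡 2) (fun y => (inner ℝ (V y) (W y) : ℝ)) x u =
      inner ℝ (covAlong cov φ V x u) (W x) + inner ℝ (V x) (covAlong cov φ W x u) := by
  have hφx := hφ.contMDiffAt.mdifferentiableAt (x := x) (by simp)
  have hm1 : IsContMDiffRiemannianBundle (𝓡 4) 1 (EuclideanSpace ℝ (Fin 4))
      (fun y : N => TangentSpace (𝓡 4) y) :=
    IsContMDiffRiemannianBundle.of_le (n := ∞) (by norm_cast)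
  -- both sides are derivations in each of the fields, so that these may be taken with constant
  -- components
  have step : ∀ (U : FieldAlong φ), DiffAlongAt φ U x →
      (∀ w : TangentSpace (𝓡 4) (φ x), mvfderiv (𝓡 2) (fun y => (inner ℝ
        (FiberBundle.extend (EuclideanSpace ℝ (Fin 4)) w (φ y)) (U y) : ℝ)) x u =
        inner ℝ (cov (FiberBundle.extend (EuclideanSpace ℝ (Fin 4)) w) (φ x) (dmap φ x u)) (U x) +
        inner ℝ w (covAlong cov φ U x u)) →
      ∀ V : FieldAlong φ, DiffAlongAt φ V x →
        mvfderiv (𝓡 2) (fun y => (inner ℝ (V y) (U y) : ℝ)) x u =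
          inner ℝ (covAlong cov φ V x u) (U x) + inner ℝ (V x) (covAlong cov φ U x u) := by
    intro U hU hext V hV
    refine (hV.induction (P := fun V => DiffAlongAt φ V x ∧
      mvfderiv (𝓡 2) (fun y => (inner ℝ (V y) (U y) : ℝ)) x u =
        inner ℝ (covAlong cov φ V x u) (U x) + inner ℝ (V x) (covAlong cov φ U x u))
      ?_ ?_ ?_ ?_).2
    · rintro V W ⟨hV, h⟩ hW
      refine ⟨hV.congr hW, ?_⟩
      rw [covAlong_congr hW, hW.self_of_nhds, ← h]
      have heq : (fun y => (inner ℝ (W y) (U y) : ℝ)) =ᶠ[𝓝 x] fun y => inner ℝ (V y) (U y) :=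
        hW.mono fun y hy => by simp only [hy]
      rw [mvfderiv_congr heq]
    · rintro V W ⟨hV, h⟩ ⟨hW, h'⟩
      refine ⟨hV.add hW, ?_⟩
      simp only [inner_add_left, covAlong_add hV hW]
      rw [mvfderiv_fun_add (hV.inner hU) (hW.inner hU), add_apply, h, h']
      ring
    · rintro f V hf ⟨hV, h⟩
      refine ⟨hV.smul hf, ?_⟩
      simp only [inner_add_left, real_inner_smul_left, covAlong_smul hf hV]
      rw [mvfderiv_fun_mul hf (hV.inner hU), add_apply, smul_apply, smul_apply, h, smul_eq_mul,
        smul_eq_mul]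
      ring
    · intro w
      refine ⟨diffAlongAt_extend hφx w, ?_⟩
      rw [covAlong_extend hφx.continuousAt, hext]
      simp only [FiberBundle.extend_apply_self]
  refine step W hW (fun w => ?_) V hV
  have h := step (fun y => FiberBundle.extend (EuclideanSpace ℝ (Fin 4)) w (φ y))
    (diffAlongAt_extend hφx w) (fun v => ?_) W hW
  · rw [covAlong_extend hφx.continuousAt, FiberBundle.extend_apply_self] at h
    simp only [real_inner_comm (FiberBundle.extend (EuclideanSpace ℝ (Fin 4)) w _)] at h
    rw [real_inner_comm, real_inner_comm (covAlong cov φ W x u) w, add_comm, ← h]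
  · have hv := (smoothAt_extend (I := 𝓡 4) v).diffAt
    have hw := (smoothAt_extend (I := 𝓡 4) w).diffAt
    have hd : MDifferentiableAt (𝓡 4) 𝓘(ℝ, ℝ) (fun y : N =>
        (inner ℝ (FiberBundle.extend (EuclideanSpace ℝ (Fin 4)) v y)
          (FiberBundle.extend (EuclideanSpace ℝ (Fin 4)) w y) : ℝ)) (φ x) :=
      MDifferentiableAt.inner_bundle (IB := 𝓡 4) (E := fun y : N => TangentSpace (𝓡 4) y)
        (b := fun y : N => y) hv hw
    have h := hcov.metric _ _ _ hv hw (dmap φ x u)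
    rw [← mvfderiv_comp_apply x hd hφx] at h
    rw [covAlong_extend hφx.continuousAt, FiberBundle.extend_apply_self]
    rw [FiberBundle.extend_apply_self, FiberBundle.extend_apply_self] at h
    exact h

/-- If `V` is the restriction of a vector field of `N`, this is the smoothness of the connection of
`N`; the expression is tensorial in `V`. -/
lemma smoothAlongAt_cov_comp (hφ : ContMDiff (𝓡 2) (𝓡 4) ∞ φ) (hcov : IsLeviCivita cov)
    {Z : Π y : N, TangentSpace (𝓡 4) y} (hZ : SmoothAt (𝓡 4) Z (φ x))
    (hV : SmoothAlongAt φ V x) : SmoothAlongAt φ (fun y => cov Z (φ y) (V y)) x := by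
  refine hV.induction (P := fun V => SmoothAlongAt φ (fun y => cov Z (φ y) (V y)) x) ?_ ?_ ?_ ?_
  · intro V W hV hW
    exact hV.congr (hW.mono fun y hy => by rw [hy])
  · intro V W hV hW
    simpa only [map_add] using hV.add hW
  · intro f V hf hV
    simpa only [map_smul] using hV.smul hf
  · intro w
    exact (hcov.smooth _ _ _ (smoothAt_extend w) hZ).smoothAlongAt_comp hφ.contMDiffAt

lemma smoothAlongAt_covAlong (hφ : ContMDiff (𝓡 2) (𝓡 4) ∞ φ) (hcov : IsLeviCivita cov)
    {X : Π x : M, TangentSpace (𝓡 2) x} (hX : SmoothAt (𝓡 2) X x) (hV : SmoothAlongAt φ V x) :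
    SmoothAlongAt φ (fun y => covAlong cov φ V y (X y)) x := by
  have hφd : ∀ y, MDifferentiableAt (𝓡 2) (𝓡 4) φ y := fun y =>
    hφ.contMDiffAt.mdifferentiableAt (by simp)
  refine (hV.induction (P := fun V => SmoothAlongAt φ V x ∧
    SmoothAlongAt φ (fun y => covAlong cov φ V y (X y)) x) ?_ ?_ ?_ ?_).2
  · rintro V W ⟨hV, h⟩ hW
    refine ⟨hV.congr hW, h.congr ?_⟩
    filter_upwards [hW.eventually_nhds] with y hy
    exact covAlong_congr hy _
  · rintro V W ⟨hV, h⟩ ⟨hW, h'⟩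
    refine ⟨hV.add hW, (h.add h').congr ?_⟩
    filter_upwards [hV.eventually_diffAlongAt, hW.eventually_diffAlongAt] with y hy hy'
    exact covAlong_add hy hy' _
  · rintro f V hf ⟨hV, h⟩
    refine ⟨hV.smul hf, ((h.smul hf).add (hV.smul (contMDiffAt_mvfderiv_apply hf hX))).congr ?_⟩
    have hf1 : ContMDiffAt (𝓡 2) 𝓘(ℝ, ℝ) 1 f x := hf.of_le (by norm_cast)
    filter_upwards [hV.eventually_diffAlongAt, (contMDiffAt_iff_contMDiffAt_nhds (by simp)).1 hf1]
      with y hy hfy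
    exact covAlong_smul (hfy.mdifferentiableAt (by simp)) hy _
  · intro w
    have hw := smoothAt_extend (I := 𝓡 4) w
    refine ⟨hw.smoothAlongAt_comp hφ.contMDiffAt,
      (smoothAlongAt_cov_comp hφ hcov hw (smoothAlongAt_dmap hφ hX)).congr ?_⟩
    filter_upwards [hφ.continuous.continuousAt.eventually hw.eventually_diffAt] with y hy
    exact covAlong_comp (hφd y) hy _

end Smooth
end CovAlong

/-! ### Torsion of the pulled back connection -/

section Torsion

variable {E : Type*} [NormedAddCommGroup E] [NormedSpace ℝ E]
  {H : Type*} [TopologicalSpace H] {I : ModelWithCorners ℝ E H}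
  {M : Type*} [TopologicalSpace M] [ChartedSpace H M] [IsManifold I ∞ M]

/-- The preferred trivialization of the tangent bundle is the derivative of the chart. -/
lemma trivializationAt_eq_mvfderiv_extChartAt {x y : M}
    (hy : y ∈ (trivializationAt E (TangentSpace I : M → Type _) x).baseSet) (u : TangentSpace I y) :
    (trivializationAt E (TangentSpace I : M → Type _) x ⟨y, u⟩).2 =
      mvfderiv I (extChartAt I x) y u := by
  have h := TangentBundle.continuousLinearMapAt_trivializationAt (𝕜 := ℝ) (I := I) (x₀ := x) (x := y)
    (by simpa using hy)
  have h1 : (trivializationAt E (TangentSpace I : M → Type _) x).continuousLinearMapAt ℝ y u =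
      mvfderiv I (extChartAt I x) y u := congrArg (fun T => T u) h
  rw [← h1, Bundle.Trivialization.continuousLinearMapAt_apply,
    Bundle.Trivialization.coe_linearMapAt_of_mem _ hy]

/-- Vector fields with constant components in a chart commute. -/
lemma mlieBracket_extend [FiniteDimensional ℝ E] [I.Boundaryless] {x : M}
    (u v : TangentSpace I x) :
    VectorField.mlieBracket I (FiberBundle.extend E u) (FiberBundle.extend E v) x = 0 := by
  have : CompleteSpace E := FiniteDimensional.complete ℝ E
  have : IsManifold I 2 M := IsManifold.of_le (n := ∞) (by norm_cast)
  have hx := mem_baseSet_trivializationAt E (TangentSpace I : M → Type _) x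
  have hconst : ∀ w : TangentSpace I x, (fun y => mvfderiv I (extChartAt I x) y
      (FiberBundle.extend E w y)) =ᶠ[𝓝 x] fun _ =>
        (trivializationAt E (TangentSpace I : M → Type _) x ⟨x, w⟩).2 := by
    intro w
    filter_upwards [(Bundle.Trivialization.open_baseSet _).mem_nhds hx] with y hy
    rw [← trivializationAt_eq_mvfderiv_extChartAt hy]
    exact trivializationAt_extend hy w
  have h := mvfderiv_mlieBracket (I := I) (f := extChartAt I x) contMDiffAt_extChartAt
    (smoothAt_extend u).diffAt (smoothAt_extend v).diffAt
  rw [mvfderiv_congr (hconst u), mvfderiv_congr (hconst v), mvfderiv_const, mvfderiv_const,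
    zero_apply, zero_apply, sub_zero, ← trivializationAt_eq_mvfderiv_extChartAt hx] at h
  rw [← Bundle.Trivialization.symm_apply_apply_mk _ hx
    (VectorField.mlieBracket I (FiberBundle.extend E u) (FiberBundle.extend E v) x), h,
    ← Bundle.Trivialization.symmL_apply (R := ℝ) _ hx, map_zero]

end Torsion

/-! ### The forms induced by an immersion are admissible -/

section Surfaces

variable {M : Type*} [TopologicalSpace M] [ChartedSpace (EuclideanSpace ℝ (Fin 2)) M]
  [IsManifold (𝓡 2) ∞ M]
  {N : Type*} [TopologicalSpace N] [ChartedSpace (EuclideanSpace ℝ (Fin 4)) N]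
  [IsManifold (𝓡 4) ∞ N] {φ : M → N} {V W : FieldAlong φ} {f : M → ℝ} {x : M}
  [RiemannianBundle (fun y : N => TangentSpace (𝓡 4) y)]
  [IsContMDiffRiemannianBundle (𝓡 4) ∞ (EuclideanSpace ℝ (Fin 4))
      (fun y : N => TangentSpace (𝓡 4) y)]
  {covN : CovariantDerivative (𝓡 4) (EuclideanSpace ℝ (Fin 4)) (TangentSpace (𝓡 4) : N → Type _)}
  {J : Π y : N, TangentSpace (𝓡 4) y →L[ℝ] TangentSpace (𝓡 4) y}

/-- The pulled back connection has no torsion. -/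
lemma covAlong_dmap_sub (hφ : ContMDiff (𝓡 2) (𝓡 4) ∞ φ) (hcov : IsLeviCivita covN)
    {X Y : Π x : M, TangentSpace (𝓡 2) x} (hX : DiffAt (𝓡 2) X x) (hY : DiffAt (𝓡 2) Y x) :
    covAlong covN φ (fun y => dmap φ y (Y y)) x (X x) -
      covAlong covN φ (fun y => dmap φ y (X y)) x (Y x) =
      dmap φ x (VectorField.mlieBracket (𝓡 2) X Y x) := by
  have hx := mem_baseSet_trivializationAt (EuclideanSpace ℝ (Fin 4))
    (TangentSpace (𝓡 4) : N → Type _) (φ x)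
  have hev := eventually_mem_chart (N := N) (hφ.continuous.continuousAt (x := x))
  have hchart : ∀ y, φ y ∈ (trivializationAt (EuclideanSpace ℝ (Fin 4))
      (TangentSpace (𝓡 4) : N → Type _) (φ x)).baseSet → ∀ u : TangentSpace (𝓡 2) y,
      (trivializationAt (EuclideanSpace ℝ (Fin 4)) (TangentSpace (𝓡 4) : N → Type _) (φ x)
        ⟨φ y, dmap φ y u⟩).2 = mvfderiv (𝓡 2) (extChartAt (𝓡 4) (φ x) ∘ φ) y u := by
    intro y hy u
    rw [trivializationAt_eq_mvfderiv_extChartAt hy]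
    have h := mfderiv_comp y (mdifferentiableAt_extChartAt (I := 𝓡 4) (x := φ x) (y := φ y)
      (by simpa using hy)) (hφ.contMDiffAt.mdifferentiableAt (x := y) (by simp))
    exact (congrArg (fun T => T u) h).symm
  have hcomp : ∀ Z : Π x : M, TangentSpace (𝓡 2) x,
      components φ (fun y => dmap φ y (Z y)) x =ᶠ[𝓝 x]
        fun y => mvfderiv (𝓡 2) (extChartAt (𝓡 4) (φ x) ∘ φ) y (Z y) := by
    intro Z
    filter_upwards [hev] with y hy
    exact hchart y hy _
  have hsm : ContMDiffAt (𝓡 2) 𝓘(ℝ, EuclideanSpace ℝ (Fin 4)) 2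
      (extChartAt (𝓡 4) (φ x) ∘ φ) x :=
    ((contMDiffAt_extChartAt (n := ∞)).comp x hφ.contMDiffAt).of_le (by norm_cast)
  have hbr := mvfderiv_mlieBracket hsm hX hY
  have htor := covN.torsion_eq_zero_iff.1 hcov.torsion_free
    (smoothAt_extend (I := 𝓡 4) (dmap φ x (X x))).diffAt
    (smoothAt_extend (I := 𝓡 4) (dmap φ x (Y x))).diffAt
  rw [mlieBracket_extend] at htor
  simp only [FiberBundle.extend_apply_self] at htor
  rw [covAlong_eq, covAlong_eq, mvfderiv_congr (hcomp X), mvfderiv_congr (hcomp Y),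
    add_sub_add_comm, htor, add_zero, ← map_sub, ← hbr, ← hchart x hx,
    Bundle.Trivialization.symmL_apply _ hx, Bundle.Trivialization.symm_apply_apply_mk _ hx]

variable [RiemannianBundle (fun x : M => TangentSpace (𝓡 2) x)]
  [IsContMDiffRiemannianBundle (𝓡 2) ∞ (EuclideanSpace ℝ (Fin 2))
      (fun x : M => TangentSpace (𝓡 2) x)]
  {covM : CovariantDerivative (𝓡 2) (EuclideanSpace ℝ (Fin 2)) (TangentSpace (𝓡 2) : M → Type _)}

namespace FundamentalForms

variable {s : FundamentalForms φ}

namespace IsInduced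

/-- The pulled back connection and that of `M` are both torsion-free. -/
lemma h_symm (hs : s.IsInduced covN covM) (hφ : IsIsometricImmersion φ)
    (hcovM : IsLeviCivita covM) (hcovN : IsLeviCivita covN) (u v : TangentSpace (𝓡 2) x) :
    s.h x u v = s.h x v u := by
  have hu := (smoothAt_extend (I := 𝓡 2) u).diffAt
  have hv := (smoothAt_extend (I := 𝓡 2) v).diffAt
  have h := covAlong_dmap_sub hφ.smooth hcovN hu hv
  rw [hs.gauss_formula _ x hu, hs.gauss_formula _ x hv,
    ← covM.torsion_eq_zero_iff.1 hcovM.torsion_free hu hv, map_sub] at h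
  simp only [FiberBundle.extend_apply_self] at h
  rw [add_sub_add_comm, add_eq_left] at h
  exact sub_eq_zero.1 h

/-- Differentiate `⟨dφ Y, ξ⟩ = 0` with the formulas of Gauss and Weingarten. -/
lemma A_dual (hs : s.IsInduced covN covM) (hφ : IsIsometricImmersion φ)
    (hcovN : IsLeviCivita covN) {u v : TangentSpace (𝓡 2) x} {ξ : TangentSpace (𝓡 4) (φ x)}
    (hξ : ξ ∈ normalSpace φ x) : (inner ℝ (s.h x u v) ξ : ℝ) = inner ℝ (s.A x ξ u) v := by
  obtain ⟨W, hW, rfl⟩ := exists_smooth_fieldAlong hφ ξ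
  have hWn := (smoothAlongAt_normalPart hφ.smooth hW).diffAlongAt
  have hn : IsNormalField φ (fun y => normalPart φ y (W y)) := fun _ => normalPart_mem hφ _
  have hv := (smoothAt_extend (I := 𝓡 2) v).diffAt
  have h := covAlong_metric hφ.smooth hcovN (diffAlongAt_dmap hφ.smooth hv) hWn u
  have h0 : (fun y => (inner ℝ (dmap φ y (FiberBundle.extend (EuclideanSpace ℝ (Fin 2)) v y))
      (normalPart φ y (W y)) : ℝ)) = fun _ => 0 :=
    funext fun y => mem_normalSpace_iff.1 (hn y) _
  rw [h0, mvfderiv_const, zero_apply, hs.gauss_formula _ x hv, hs.weingarten_formula _ hn x hWn]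
    at h
  simp only [FiberBundle.extend_apply_self, normalPart_of_mem hξ, inner_add_left, inner_add_right,
    inner_neg_right, hφ.isometric, mem_normalSpace_iff.1 hξ,
    mem_normalSpace_iff.1 (hs.D_normal _ hn x u)] at h
  rw [real_inner_comm v]
  linarith

/-- On normal fields, `D` is the normal part of the pulled back connection. -/
lemma D_eq (hs : s.IsInduced covN covM) {ξ : FieldAlong φ}
    (hξ : IsNormalField φ ξ) (hd : DiffAlongAt φ ξ x) (u : TangentSpace (𝓡 2) x) :
    s.D ξ x u = covAlong covN φ ξ x u + dmap φ x (s.A x (ξ x) u) := by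
  rw [hs.weingarten_formula ξ hξ x hd]
  abel

/-- The formulas of Gauss and Weingarten say that the connection assembled from the induced data
is the pulled back one. -/
lemma connection_eq_covAlong (hs : s.IsInduced covN covM) (hφ : IsIsometricImmersion φ)
    (hV : DiffAlongAt φ V x) (u : TangentSpace (𝓡 2) x) :
    s.connection covM V x u = covAlong covN φ V x u := by
  have hT := diffAt_tangentialPart hφ.smooth hV
  have hd := diffAlongAt_dmap hφ.smooth hT
  have hn := diffAlongAt_normalPart hφ.smooth hV
  have h := covAlong_add (cov := covN) hd hn u
  simp only [dmap_tangentialPart_add_normalPart] at h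
  rw [h, hs.gauss_formula _ x hT, hs.weingarten_formula _ (fun _ => normalPart_mem hφ _) x hn,
    connection]
  abel

/-- The second fundamental form, the shape operators and the normal connection of `φ` are
admissible data. -/
theorem isAdmissible (hs : s.IsInduced covN covM) (hφ : IsIsometricImmersion φ)
    (hcovM : IsLeviCivita covM) (hN : IsKaehler covN J) : s.IsAdmissible covM J where
  toNormalValued := hs.toNormalValued
  h_smooth X Y x hX hY := by
    refine ((smoothAlongAt_covAlong hφ.smooth hN.leviCivita hX (smoothAlongAt_dmap hφ.smooth hY)).sub
      (smoothAlongAt_dmap hφ.smooth (hcovM.smooth X Y x hX hY))).congr ?_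
    filter_upwards [hY.eventually_diffAt] with y hy
    rw [hs.gauss_formula Y y hy, add_sub_cancel_left]
  h_symm x u v := hs.h_symm hφ hcovM hN.leviCivita u v
  A_dual x u v ξ hξ := hs.A_dual hφ hN.leviCivita hξ
  D_smooth X ξ hξ x hX hξs := by
    have h := smoothAlongAt_normalPart hφ.smooth
      (smoothAlongAt_covAlong hφ.smooth hN.leviCivita hX hξs)
    refine h.congr ?_
    filter_upwards [hξs.eventually_diffAlongAt] with y hy
    rw [hs.weingarten_formula ξ hξ y hy, ← map_neg, normalPart_dmap_add hφ _ (hs.D_normal ξ hξ _ _)]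
  D_add ξ η hξ hη x hξd hηd := by
    ext1 u
    have hn : IsNormalField φ (ξ + η) := fun y => Submodule.add_mem _ (hξ y) (hη y)
    have h := covAlong_add (cov := covN) hξd hηd u
    rw [add_apply, hs.D_eq hξ hξd, hs.D_eq hη hηd, hs.D_eq hn (hξd.add hηd),
      Pi.add_apply, map_add, add_apply, map_add]
    exact (congrArg (· + _) h).trans (add_add_add_comm _ _ _ _)
  D_leibniz f ξ hξ x hf hξd u := by
    have hn : IsNormalField φ fun y => f y • ξ y := fun y => Submodule.smul_mem _ _ (hξ y)
    rw [hs.D_eq hξ hξd, hs.D_eq hn (hξd.smul hf), covAlong_smul hf hξd, map_smul, smul_apply,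
      map_smul, smul_add]
    abel
  D_metric ξ η hξ hη x hξd hηd u := by
    rw [covAlong_metric hφ.smooth hN.leviCivita hξd hηd, hs.D_eq hξ hξd, hs.D_eq hη hηd,
      inner_add_left, inner_add_right, mem_normalSpace_iff.1 (hη x),
      real_inner_comm _ (ξ x), real_inner_comm _ (ξ x), mem_normalSpace_iff.1 (hξ x), add_zero, add_zero]
  J_parallel V x hV u := by
    rw [hs.connection_eq_covAlong hφ (hV.end_apply hN.smooth hφ.smooth),
      hs.connection_eq_covAlong hφ hV, covAlong_end_apply hφ.smooth hN hV]

end IsInduced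

end FundamentalForms

end Surfaces

end KaehlerSurface

end

theorem theorem4p2
    {M : Type*} [TopologicalSpace M] [ChartedSpace (EuclideanSpace ℝ (Fin 2)) M]
    [IsManifold (𝓡 2) ∞ M]
    [RiemannianBundle (fun x : M => TangentSpace (𝓡 2) x)]
    [IsContMDiffRiemannianBundle (𝓡 2) ∞ (EuclideanSpace ℝ (Fin 2))
      (fun x : M => TangentSpace (𝓡 2) x)]
    {N : Type*} [TopologicalSpace N] [ChartedSpace (EuclideanSpace ℝ (Fin 4)) N]
    [IsManifold (𝓡 4) ∞ N]
    [RiemannianBundle (fun y : N => TangentSpace (𝓡 4) y)]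
    [IsContMDiffRiemannianBundle (𝓡 4) ∞ (EuclideanSpace ℝ (Fin 4))
      (fun y : N => TangentSpace (𝓡 4) y)]
    (covM : CovariantDerivative (𝓡 2) (EuclideanSpace ℝ (Fin 2))
      (TangentSpace (𝓡 2) : M → Type _))
    (covN : CovariantDerivative (𝓡 4) (EuclideanSpace ℝ (Fin 4))
      (TangentSpace (𝓡 4) : N → Type _))
    (J : Π y : N, TangentSpace (𝓡 4) y →L[ℝ] TangentSpace (𝓡 4) y)
    (hcovM : IsLeviCivita covM)
    (hN : IsKaehler covN J)
    (φ : M → N) (hφ : IsIsometricImmersion φ) (hreal : IsPurelyReal J φ) :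
    -- for the second fundamental form, shape operators and normal connection of the surface
    (∀ s : FundamentalForms φ, s.IsInduced covN covM →
      s.CodazziEquation covN covM → s.RicciEquation covN → s.GaussEquation covN covM) ∧
    -- as a formal consequence, for all data that are compatible with the Kaehler structure
    (∀ s : FundamentalForms φ, s.IsAdmissible covM J →
      s.CodazziEquation covN covM → s.RicciEquation covN → s.GaussEquation covN covM) := by
  exact ⟨fun _ hs => (hs.isAdmissible hφ hcovM hN).gaussEquation hφ hcovM hN hreal,
    fun _ hs => hs.gaussEquation hφ hcovM hN hreal⟩
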